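/- Consider a flat FLRW spacetime $g=-dt^2+a(t)^2(dx^2+dy^2+dz^2)$ on $t<T$ ($T\in\mathbb R$), with $a>0$ of class $C^2$ and $a(t)\to0$ as $t\to-\infty$. Let $H=\dot a/a$. Suppose that $g$ solves Einstein's equation $G_{\mu\nu}+\frac{\Lambda}{M^2}g_{\mu\nu}=\frac1{M^2}T_{\mu\nu}$, where $M>0$ is the reduced Planck mass, $\Lambda>0$ is the vacuum energy density, and $T_{\mu\nu}=(\rho+P)u_\mu u_\nu+Pg_{\mu\nu}$, $u=\partial_t$, is a perfect fluid with energy density $\rho(t)$, not identically zero, and pressure $P=w\rho$ with constant $w\le-1$. Terminology. Consider affinely parametrized null geodesics $\gamma:(0,\delta)\to\{t<T\}$, $0<\delta<\infty$, along which $t\to-\infty$ as the affine parameter $\lambda\to0^+$, and orthonormal tetrads $(E_0,\dots,E_3)$ parallelly propagated (p.p.) along $\gamma$. For $r\in\mathbb Z_{\ge0}$, the past boundary $\mathscr B^-$ (the limit $t\to-\infty$) is a *$C^r$ p.p. curvature singularity* if for some such $\gamma$ and $E$ some component, with respect to $E$, of the $r$-th covariant derivative of the Riemann tensor has no finite limit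 as $\lambda\to0^+$. Otherwise the spacetime is called *$C^r$ extendible* at $\mathscr B^-$; it is *$C^\infty$ extendible* if it is $C^r$ extendible for every $r\ge 0$. Then: 1. There are $H_\Lambda>0$ and $\bar a>0$ with $a(t)\sim\bar a\,e^{H_\Lambda t}$ as $t\to-\infty$, and $H_\Lambda=\sqrt{\Lambda/(3M^2)}$ if $w<-1$. Null geodesics $\gamma$ as above, carrying a p.p. tetrad, exist, so that the spacetime is past null incomplete. 2. There is a constant $C\neq0$ such that for all $t<T$ $$\rho=C\,a^{-3(1+w)},\qquad \frac{\dot H}{a^2}=-\frac{C}{2M^2}\,\frac{1+w}{a^{5+3w}}.$$ 3. $\dot H/a^2$ has a finite limit as $t\to-\infty$ if and only if $w=-1$ or $w\le-5/3$. 4. The spacetime is $C^0$ extendible at $\mathscr B^-$ if and only if $w=-1$ or $w\le-5/3$. 5. If $-5/3<w<-1$, then $|\dot H/a^2|\to\infty$ as $t\to-\infty$ and $\mathscr B^-$ is a $C^0$ p.p. curvature singularity; moreover, along every $\gamma$ as above and for every p.p. tetrad along it, the absolute value of some component of the Riemann tensor tends to $\infty$ as $\lambda\to0^+$. 6. If $w\le-5/3$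 and $-5-3w$ is an integer, then the spacetime is $C^\infty$ extendible at $\mathscr B^-$. 7. If $w\le-5/3$ and $w$ is not an integer multiple of $1/3$, then the spacetime is at most $C^{\lfloor-3w\rfloor-5}$ extendible: if it is $C^r$ extendible at $\mathscr B^-$, then $r\le\lfloor-3w\rfloor-5$. -/

import Mathlib

open Set Filter Topology Asymptotics

noncomputable section

namespace FLRW

/-- Points of the coordinate chart `(t, x, y, z)`; the index `0` is the time coordinate `t`. -/
abbrev Point : Type := Fin 4 → ℝ

/-- A metric in coordinates: `g x μ ν`. -/
abbrev Metric : Type := Point → Matrix (Fin 4) (Fin 4) ℝ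

/-- Covariant tensor fields of rank `k` in coordinates: `S x (μ₁, …, μₖ)`. -/
abbrev CovTensor (k : ℕ) : Type := Point → (Fin k → Fin 4) → ℝ

/-- The coordinate derivative `∂_σ f` at `x`. -/
def pderiv (σ : Fin 4) (f : Point → ℝ) (x : Point) : ℝ :=
  fderiv ℝ f x (Pi.single σ 1)

/-- The Christoffel symbol `Γ^ρ_{μν}` of the Levi-Civita connection of `g`. -/
def christoffel (g : Metric) (ρ μ ν : Fin 4) (x : Point) : ℝ :=
  (1 / 2) * ∑ σ, (g x)⁻¹ ρ σ *
    (pderiv μ (fun y => g y σ ν) x + pderiv ν (fun y => g y σ μ) x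
      - pderiv σ (fun y => g y μ ν) x)

/-- The curvature tensor `R^ρ_{σμν}`. -/
def riemannUp (g : Metric) (ρ σ μ ν : Fin 4) (x : Point) : ℝ :=
  pderiv μ (christoffel g ρ ν σ) x - pderiv ν (christoffel g ρ μ σ) x
    + ∑ τ, (christoffel g ρ μ τ x * christoffel g τ ν σ x
      - christoffel g ρ ν τ x * christoffel g τ μ σ x)

/-- The Riemann tensor `R_{ρσμν}` as a covariant tensor field of rank four. -/
def riemann (g : Metric) : CovTensor 4 := fun x i =>
  ∑ τ, g x (i 0) τ * riemannUp g τ (i 1) (i 2) (i 3) x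

/-- The Ricci tensor `R_{μν} = R^ρ_{μρν}`. -/
def ricci (g : Metric) (μ ν : Fin 4) (x : Point) : ℝ :=
  ∑ ρ, riemannUp g ρ μ ρ ν x

/-- The scalar curvature `g^{μν} R_{μν}`. -/
def scalarCurvature (g : Metric) (x : Point) : ℝ :=
  ∑ μ, ∑ ν, (g x)⁻¹ μ ν * ricci g μ ν x

/-- The Einstein tensor `R_{μν} - (1/2) R g_{μν}`. -/
def einsteinTensor (g : Metric) (μ ν : Fin 4) (x : Point) : ℝ :=
  ricci g μ ν x - (1 / 2) * scalarCurvature g x * g x μ ν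

/-- The covariant derivative `∇_{μ₀} S_{μ₁ … μₖ}`; the differentiation index comes first. -/
def covDeriv (g : Metric) {k : ℕ} (S : CovTensor k) : CovTensor (k + 1) := fun x μ =>
  pderiv (μ 0) (fun y => S y (Fin.tail μ)) x
    - ∑ j : Fin k, ∑ ρ, christoffel g ρ (μ 0) (Fin.tail μ j) x *
        S x (Function.update (Fin.tail μ) j ρ)

/-- The `r`-th covariant derivative of the Riemann tensor. -/
def iterCovDerivRiemann (g : Metric) : (r : ℕ) → CovTensor (4 + r)
  | 0 => riemann g
  | r + 1 => covDeriv g (iterCovDerivRiemann g r)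

/-- The component `S(E_{m₁}, …, E_{mₖ})` at `x` of `S` with respect to a tetrad of vectors,
where `E m μ` is the `μ`-th coordinate of the vector `E_m`. -/
def frameComponent {k : ℕ} (S : CovTensor k) (x : Point) (E : Fin 4 → Fin 4 → ℝ)
    (m : Fin k → Fin 4) : ℝ :=
  ∑ μ : Fin k → Fin 4, S x μ * ∏ j, E (m j) (μ j)

/-- The flat FLRW metric `-dt² + a(t)² (dx² + dy² + dz²)`. -/
def flrwMetric (a : ℝ → ℝ) : Metric := fun x =>
  Matrix.diagonal (fun i => if i = 0 then -1 else a (x 0) ^ 2)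

/-- The Hubble parameter `H = ȧ / a`. -/
def hubble (a : ℝ → ℝ) (t : ℝ) : ℝ := deriv a t / a t

/-- The energy-momentum tensor `(ρ + P) u_μ u_ν + P g_{μν}` of a perfect fluid at rest with
respect to the comoving observers, `u = ∂_t`, with energy density `ρ(t)` and pressure `P(t)`. -/
def fluidTensor (a ρ P : ℝ → ℝ) (μ ν : Fin 4) (x : Point) : ℝ :=
  (ρ (x 0) + P (x 0)) * (if μ = 0 ∧ ν = 0 then 1 else 0) + P (x 0) * flrwMetric a x μ ν

/-- Einstein's equation `G_{μν} + (Λ / M²) g_{μν} = T_{μν} / M²` on the flat FLRW spacetime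
`t < T`, where `M` is the reduced Planck mass, `Λ` is the vacuum energy density, and the matter
is a comoving perfect fluid with equation of state `P = w ρ`. -/
def SolvesEinstein (M Λ w T : ℝ) (a ρ : ℝ → ℝ) : Prop :=
  ∀ x : Point, x 0 < T → ∀ μ ν : Fin 4,
    einsteinTensor (flrwMetric a) μ ν x + Λ / M ^ 2 * flrwMetric a x μ ν
      = fluidTensor a ρ (fun t => w * ρ t) μ ν x / M ^ 2

/-- `γ` is an affinely parametrized null geodesic with tangent `k`, defined on the finite
parameter interval `(0, δ)`, inside the spacetime `t < T`, which runs into the past boundary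
`t → -∞` as its affine parameter decreases to `0`. -/
structure IsNullGeodesicFromPast (a : ℝ → ℝ) (T δ : ℝ) (γ k : ℝ → Point) : Prop where
  pos : 0 < δ
  mem : ∀ s ∈ Ioo 0 δ, γ s 0 < T
  tangent : ∀ s ∈ Ioo 0 δ, HasDerivAt γ (k s) s
  geodesic : ∀ s ∈ Ioo 0 δ, ∀ μ, HasDerivAt (fun u => k u μ)
    (-∑ α, ∑ β, christoffel (flrwMetric a) μ α β (γ s) * k s α * k s β) s
  ne_zero : ∀ s ∈ Ioo 0 δ, k s ≠ 0
  null : ∀ s ∈ Ioo 0 δ, ∑ α, ∑ β, flrwMetric a (γ s) α β * k s α * k s β = 0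
  toBoundary : Tendsto (fun s => γ s 0) (𝓝[>] 0) atBot

/-- `E` is a parallelly propagated (p.p.) orthonormal tetrad along the curve `γ` with tangent
`k`; `E s m μ` is the `μ`-th coordinate of the tetrad vector `E_m` at parameter `s`. -/
structure IsPPTetrad (a : ℝ → ℝ) (δ : ℝ) (γ k : ℝ → Point) (E : ℝ → Fin 4 → Fin 4 → ℝ) :
    Prop where
  orthonormal : ∀ s ∈ Ioo 0 δ, ∀ m n,
    ∑ α, ∑ β, flrwMetric a (γ s) α β * E s m α * E s n β
      = if m = n then (if m = 0 then -1 else 1) else 0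
  parallel : ∀ s ∈ Ioo 0 δ, ∀ m μ, HasDerivAt (fun u => E u m μ)
    (-∑ α, ∑ β, christoffel (flrwMetric a) μ α β (γ s) * k s α * E s m β) s

/-- The component, with tetrad indices `m`, of the `r`-th covariant derivative of the Riemann
tensor at the parameter `s` of the curve `γ`. -/
def ppComponent (a : ℝ → ℝ) (r : ℕ) (γ : ℝ → Point) (E : ℝ → Fin 4 → Fin 4 → ℝ)
    (m : Fin (4 + r) → Fin 4) (s : ℝ) : ℝ :=
  frameComponent (iterCovDerivRiemann (flrwMetric a) r) (γ s) (E s) m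

/-- Null geodesics are past incomplete: some null geodesic, carrying a p.p. tetrad, reaches
`t → -∞` at a finite value of its affine parameter. -/
def HasPastBoundary (a : ℝ → ℝ) (T : ℝ) : Prop :=
  ∃ δ γ k E, IsNullGeodesicFromPast a T δ γ k ∧ IsPPTetrad a δ γ k E

/-- The past boundary is a `C^r` p.p. curvature singularity: some component, in a p.p. tetrad
along a null geodesic, of the `r`-th covariant derivative of the Riemann tensor has no finite
limit toward the boundary. -/
def IsPPCurvatureSingularity (a : ℝ → ℝ) (T : ℝ) (r : ℕ) : Prop :=
  ∃ δ γ k E, IsNullGeodesicFromPast a T δ γ k ∧ IsPPTetrad a δ γ k E ∧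
    ∃ m, ¬ ∃ L : ℝ, Tendsto (ppComponent a r γ E m) (𝓝[>] 0) (𝓝 L)

/-- `C^r` extendibility of the past boundary: it is not a `C^r` p.p. curvature singularity. -/
def IsExtendible (a : ℝ → ℝ) (T : ℝ) (r : ℕ) : Prop :=
  ¬ IsPPCurvatureSingularity a T r

/-- `C^∞` extendibility of the past boundary. -/
def IsSmoothlyExtendible (a : ℝ → ℝ) (T : ℝ) : Prop :=
  ∀ r : ℕ, IsExtendible a T r

end FLRW

end

open scoped ContDiff

namespace FLRW

/-! Let `ℓ = -a dt`. The Riemann tensor of a flat FLRW metric is `H²` times the constant-curvature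
tensor built from `g`, minus `Ḣ/a²` times an expression quadratic in `ℓ` and linear in `g`
(`ev_riemann`). Einstein's equation gives `ρ = C a^(-3(1+w))`, so `H²` is a constant plus a multiple
of `a^(-3(1+w))`, and `Ḣ/a²` is a multiple of `a^p` with `p = -5-3w`. In particular `H` has a
positive limit in the past.

In a p.p. tetrad the components of `g` are constant. Since `∇ℓ = ȧ g`, those of `ℓ` can be
integrated explicitly: they converge to a nonzero null covector
(`IsNullGeodesicFromPast.exists_tendsto_ell`). Thus the curvature components converge as soon as
`Ḣ/a²` does, and if `|Ḣ/a²|` tends to infinity, some component diverges along every geodesic.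

For higher derivatives, consider tensors whose values are smooth functions of `a`, `ℓ` and the inner
products of the arguments. This class is closed under `∇` when `H` is a smooth function of `a`
(`IsScaleTensor.covDeriv`). If `p` is a natural number, `H` and `Ḣ/a²` are smooth across `a = 0`, so
all components converge (`isSmoothlyExtendible_of_pow`).

If `p` is not a natural number, take the explicit null geodesic with `dt/ds = 1/a`, along which
`da/ds = H`. Contracting `∇^r R` with its tangent `k` and a transverse parallel vector gives the
`r`-th derivative in `s` of a multiple of `a^p`. This behaves like a nonzero multiple of `a^(p-r)`
and diverges once `r > p` (`isPPCurvatureSingularity_of_rpow`). -/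

/-! ### Christoffel symbols and curvature of the flat FLRW metric. -/

lemma pderiv_congr {f g : Point → ℝ} {x : Point} (σ : Fin 4) (h : f =ᶠ[𝓝 x] g) :
    pderiv σ f x = pderiv σ g x := by
  unfold pderiv; rw [h.fderiv_eq]

lemma pderiv_comp_time {f : ℝ → ℝ} {f' : ℝ} {x : Point} (σ : Fin 4)
    (h : HasDerivAt f f' (x 0)) :
    pderiv σ (fun y => f (y 0)) x = if σ = 0 then f' else 0 := by
  have h2 : HasFDerivAt (fun y : Point => f (y 0))
      (f' • ContinuousLinearMap.proj (R := ℝ) (φ := fun _ : Fin 4 => ℝ) 0) x :=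
    h.comp_hasFDerivAt x (ContinuousLinearMap.proj (R := ℝ) (φ := fun _ : Fin 4 => ℝ) 0).hasFDerivAt
  unfold pderiv
  rw [h2.fderiv]
  by_cases hσ : σ = 0
  · subst hσ; simp
  · have : (0 : Fin 4) ≠ σ := fun h => hσ h.symm
    simp [hσ]

lemma eventually_time_lt {T : ℝ} {x : Point} (hx : x 0 < T) : ∀ᶠ y : Point in 𝓝 x, y 0 < T :=
  (continuous_apply (0 : Fin 4)).continuousAt.eventually (Iio_mem_nhds hx)

section C2

variable {a : ℝ → ℝ} {T : ℝ}

lemma hasDerivAt_scale (ha : ContDiffOn ℝ 2 a (Iio T)) {t : ℝ} (ht : t < T) :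
    HasDerivAt a (deriv a t) t :=
  ((ha.differentiableOn (by norm_num)).differentiableAt (Iio_mem_nhds ht)).hasDerivAt

lemma hasDerivAt_deriv_scale (ha : ContDiffOn ℝ 2 a (Iio T)) {t : ℝ} (ht : t < T) :
    HasDerivAt (deriv a) (deriv (deriv a) t) t := by
  have h1 : ContDiffOn ℝ 1 (deriv a) (Iio T) := ha.deriv_of_isOpen isOpen_Iio (by norm_num)
  exact ((h1.differentiableOn (by norm_num)).differentiableAt (Iio_mem_nhds ht)).hasDerivAt

end C2

/-- The Christoffel symbols of a flat FLRW metric, with `p = a ȧ` and `q = ȧ / a`. -/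
def flrwGamma (p q : ℝ) (ρ μ ν : Fin 4) : ℝ :=
  if ρ = 0 then (if μ = ν ∧ μ ≠ 0 then p else 0)
  else if (μ = 0 ∧ ν = ρ) ∨ (ν = 0 ∧ μ = ρ) then q else 0

lemma flrwMetric_inv {a : ℝ → ℝ} {x : Point} (hx : a (x 0) ≠ 0) :
    (flrwMetric a x)⁻¹
      = Matrix.diagonal (fun i : Fin 4 => if i = 0 then -1 else (a (x 0) ^ 2)⁻¹) := by
  apply Matrix.inv_eq_right_inv
  unfold flrwMetric
  rw [Matrix.diagonal_mul_diagonal, ← Matrix.diagonal_one]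
  congr 1
  ext i
  split_ifs <;> field_simp

section C2

variable {a : ℝ → ℝ} {T : ℝ}

lemma pderiv_flrwMetric (ha : ContDiffOn ℝ 2 a (Iio T)) {x : Point} (hx : x 0 < T)
    (σ μ ν : Fin 4) : pderiv σ (fun y => flrwMetric a y μ ν) x =
      if σ = 0 ∧ μ = ν ∧ μ ≠ 0 then 2 * (a (x 0) * deriv a (x 0)) else 0 := by
  by_cases h : μ = ν
  · subst h
    by_cases h0 : μ = 0
    · subst h0
      have := pderiv_comp_time (x := x) σ (hasDerivAt_const (x 0) (-1 : ℝ))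
      simpa [flrwMetric] using this
    · have := pderiv_comp_time (x := x) σ ((hasDerivAt_scale ha hx).pow 2)
      simp only [flrwMetric, Matrix.diagonal_apply_eq, if_neg h0]
      simp only [Pi.pow_apply] at this
      rw [this]
      by_cases hσ : σ = 0 <;> simp [hσ, h0]; ring
  · have := pderiv_comp_time (x := x) σ (hasDerivAt_const (x 0) (0 : ℝ))
    simp only [flrwMetric, Matrix.diagonal_apply_ne _ h]
    simpa [h] using this

lemma christoffel_flrwMetric (ha : ContDiffOn ℝ 2 a (Iio T)) (ha_pos : ∀ t < T, 0 < a t)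
    {x : Point} (hx : x 0 < T) (ρ μ ν : Fin 4) :
    christoffel (flrwMetric a) ρ μ ν x
      = flrwGamma (a (x 0) * deriv a (x 0)) (deriv a (x 0) / a (x 0)) ρ μ ν := by
  have h0 := (ha_pos _ hx).ne'
  unfold christoffel
  rw [flrwMetric_inv h0]
  simp only [pderiv_flrwMetric ha hx, Matrix.diagonal_apply, ite_mul, zero_mul,
    Finset.sum_ite_eq, Finset.mem_univ, if_true]
  generalize a (x 0) = A at *
  generalize deriv a (x 0) = B
  fin_cases ρ <;> fin_cases μ <;> fin_cases ν <;> simp [flrwGamma] <;> field_simp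

/-- `(a ȧ)˙` and `(ȧ / a)˙`. -/
lemma hasDerivAt_gamma_coeff (ha : ContDiffOn ℝ 2 a (Iio T)) (ha_pos : ∀ t < T, 0 < a t)
    {t : ℝ} (ht : t < T) (ρ μ ν : Fin 4) :
    HasDerivAt (fun t => flrwGamma (a t * deriv a t) (deriv a t / a t) ρ μ ν)
      (flrwGamma (deriv a t ^ 2 + a t * deriv (deriv a) t)
        (deriv (deriv a) t / a t - deriv a t ^ 2 / a t ^ 2) ρ μ ν) t := by
  have h1 := hasDerivAt_scale ha ht
  have h2 := hasDerivAt_deriv_scale ha ht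
  have h0 := (ha_pos _ ht).ne'
  unfold flrwGamma
  split_ifs
  · exact (h1.mul h2).congr_deriv (by ring)
  · exact hasDerivAt_const _ _
  · exact (h2.div h1 h0).congr_deriv (by field_simp)
  · exact hasDerivAt_const _ _

lemma pderiv_christoffel (ha : ContDiffOn ℝ 2 a (Iio T)) (ha_pos : ∀ t < T, 0 < a t)
    {x : Point} (hx : x 0 < T) (σ ρ μ ν : Fin 4) :
    pderiv σ (christoffel (flrwMetric a) ρ μ ν) x =
      if σ = 0 then flrwGamma (deriv a (x 0) ^ 2 + a (x 0) * deriv (deriv a) (x 0))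
        (deriv (deriv a) (x 0) / a (x 0) - deriv a (x 0) ^ 2 / a (x 0) ^ 2) ρ μ ν else 0 := by
  rw [← pderiv_comp_time σ (hasDerivAt_gamma_coeff ha ha_pos hx ρ μ ν)]
  apply pderiv_congr
  filter_upwards [eventually_time_lt hx] with y hy
  exact christoffel_flrwMetric ha ha_pos hy ρ μ ν

/-- The values of the covector `-a dt`. -/
def ell (a : ℝ → ℝ) (x : Point) (v : Fin 4 → ℝ) : ℝ := -a (x 0) * v 0

/-- The inner product of two vectors at a point. -/
def ip (a : ℝ → ℝ) (x : Point) (v w : Fin 4 → ℝ) : ℝ :=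
  ∑ α, ∑ β, flrwMetric a x α β * v α * w β

lemma ip_eq (a : ℝ → ℝ) (x : Point) (v w : Fin 4 → ℝ) :
    ip a x v w = -(v 0 * w 0) + a (x 0) ^ 2 * (v 1 * w 1 + v 2 * w 2 + v 3 * w 3) := by
  simp [ip, flrwMetric, Matrix.diagonal_apply, Fin.sum_univ_four]
  ring

lemma riemannUp_flrwMetric (ha : ContDiffOn ℝ 2 a (Iio T)) (ha_pos : ∀ t < T, 0 < a t)
    {x : Point} (hx : x 0 < T) (ρ σ μ ν : Fin 4) :
    riemannUp (flrwMetric a) ρ σ μ ν x =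
      (if ρ = 0 then
        (if σ ≠ 0 ∧ μ = 0 ∧ ν = σ then a (x 0) * deriv (deriv a) (x 0)
        else if σ ≠ 0 ∧ ν = 0 ∧ μ = σ then -(a (x 0) * deriv (deriv a) (x 0)) else 0)
      else if σ = 0 then
        (if μ = 0 ∧ ν = ρ then deriv (deriv a) (x 0) / a (x 0)
        else if ν = 0 ∧ μ = ρ then -(deriv (deriv a) (x 0) / a (x 0)) else 0)
      else if μ ≠ ν ∧ μ = ρ ∧ ν = σ then deriv a (x 0) ^ 2
      else if μ ≠ ν ∧ μ = σ ∧ ν = ρ then -(deriv a (x 0) ^ 2) else 0) := by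
  have h0 := (ha_pos _ hx).ne'
  unfold riemannUp
  simp only [pderiv_christoffel ha ha_pos hx, christoffel_flrwMetric ha ha_pos hx,
    Fin.sum_univ_four]
  generalize a (x 0) = A at *
  generalize deriv a (x 0) = B
  generalize deriv (deriv a) (x 0) = D
  fin_cases ρ <;> fin_cases σ <;> fin_cases μ <;> fin_cases ν <;>
    simp [flrwGamma] <;> field_simp <;> ring

end C2

/-! ### Friedmann equations and the Riemann tensor in terms of `g` and `-a dt`. -/

section Curvature

variable {a : ℝ → ℝ} {T : ℝ}

lemma hasDerivAt_hubble (ha : ContDiffOn ℝ 2 a (Iio T)) (ha_pos : ∀ t < T, 0 < a t)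
    {t : ℝ} (ht : t < T) : HasDerivAt (hubble a)
      (deriv (deriv a) t / a t - deriv a t ^ 2 / a t ^ 2) t := by
  have h0 := (ha_pos _ ht).ne'
  exact ((hasDerivAt_deriv_scale ha ht).div (hasDerivAt_scale ha ht) h0).congr_deriv
    (by field_simp)

lemma ricci_zero_zero (ha : ContDiffOn ℝ 2 a (Iio T)) (ha_pos : ∀ t < T, 0 < a t)
    {x : Point} (hx : x 0 < T) :
    ricci (flrwMetric a) 0 0 x = -3 * (deriv (deriv a) (x 0) / a (x 0)) := by
  simp only [ricci, riemannUp_flrwMetric ha ha_pos hx, Fin.sum_univ_four]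
  simp; ring

lemma ricci_space (ha : ContDiffOn ℝ 2 a (Iio T)) (ha_pos : ∀ t < T, 0 < a t)
    {x : Point} (hx : x 0 < T) (i : Fin 4) (hi : i ≠ 0) :
    ricci (flrwMetric a) i i x = a (x 0) * deriv (deriv a) (x 0) + 2 * deriv a (x 0) ^ 2 := by
  simp only [ricci, riemannUp_flrwMetric ha ha_pos hx, Fin.sum_univ_four]
  fin_cases i <;> simp at hi ⊢ <;> ring

lemma scalarCurvature_flrwMetric (ha : ContDiffOn ℝ 2 a (Iio T)) (ha_pos : ∀ t < T, 0 < a t)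
    {x : Point} (hx : x 0 < T) : scalarCurvature (flrwMetric a) x
      = 6 * (deriv (deriv a) (x 0) / a (x 0) + deriv a (x 0) ^ 2 / a (x 0) ^ 2) := by
  have h0 := (ha_pos _ hx).ne'
  simp only [scalarCurvature, flrwMetric_inv h0, Matrix.diagonal_apply, ite_mul, zero_mul,
    Finset.sum_ite_eq, Finset.mem_univ, if_true, Fin.sum_univ_four]
  rw [ricci_zero_zero ha ha_pos hx, ricci_space ha ha_pos hx 1 (by decide),
    ricci_space ha ha_pos hx 2 (by decide), ricci_space ha ha_pos hx 3 (by decide)]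
  simp
  field_simp
  ring

/-- The `00` component is the first claim. Eliminating `ä` between it and the `11` component gives
the second. -/
lemma friedmann (ha : ContDiffOn ℝ 2 a (Iio T)) (ha_pos : ∀ t < T, 0 < a t)
    {M Λ w : ℝ} {ρ : ℝ → ℝ} (hM : 0 < M) (hE : SolvesEinstein M Λ w T a ρ) {t : ℝ} (ht : t < T) :
    ρ t = 3 * M ^ 2 * hubble a t ^ 2 - Λ ∧
      HasDerivAt (hubble a) (-((1 + w) * ρ t / (2 * M ^ 2))) t := by
  have h0 := (ha_pos _ ht).ne'
  let x : Point := fun _ => t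
  have e0 := hE x ht 0 0
  have e1 := hE x ht 1 1
  simp only [einsteinTensor, ricci_zero_zero ha ha_pos (x := x) ht,
    ricci_space ha ha_pos (x := x) ht 1 (by decide),
    scalarCurvature_flrwMetric ha ha_pos (x := x) ht, fluidTensor, flrwMetric,
    Matrix.diagonal_apply_eq] at e0 e1
  simp [x] at e0 e1
  have k0 : ρ t = 3 * M ^ 2 * hubble a t ^ 2 - Λ := by
    unfold hubble
    field_simp at e0 ⊢
    linarith
  refine ⟨k0, (hasDerivAt_hubble ha ha_pos ht).congr_deriv ?_⟩
  have k1 : M ^ 2 * (2 * a t * deriv (deriv a) t + deriv a t ^ 2)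
      = (Λ - w * ρ t) * a t ^ 2 := by
    field_simp at e1
    linarith
  have k2 : ρ t * a t ^ 2 = 3 * M ^ 2 * deriv a t ^ 2 - Λ * a t ^ 2 := by
    rw [k0, hubble]; field_simp
  field_simp
  linarith

/-- This splitting isolates `Ḣ/a²` as the only coefficient that can diverge at the past boundary. -/
lemma riemann_flrwMetric (ha : ContDiffOn ℝ 2 a (Iio T)) (ha_pos : ∀ t < T, 0 < a t)
    {x : Point} (hx : x 0 < T) (i : Fin 4 → Fin 4) :
    riemann (flrwMetric a) x i =
      let g := flrwMetric a x
      let l : Fin 4 → ℝ := fun j => if j = 0 then -a (x 0) else 0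
      hubble a (x 0) ^ 2 * (g (i 0) (i 2) * g (i 1) (i 3) - g (i 0) (i 3) * g (i 1) (i 2))
      - deriv (hubble a) (x 0) / a (x 0) ^ 2 *
        (l (i 0) * l (i 2) * g (i 1) (i 3) + l (i 1) * l (i 3) * g (i 0) (i 2)
          - l (i 0) * l (i 3) * g (i 1) (i 2) - l (i 1) * l (i 2) * g (i 0) (i 3)) := by
  have h0 := (ha_pos _ hx).ne'
  rw [(hasDerivAt_hubble ha ha_pos hx).deriv]
  simp only [riemann, riemannUp_flrwMetric ha ha_pos hx, flrwMetric, Matrix.diagonal_apply,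
    ite_mul, zero_mul, Finset.sum_ite_eq, Finset.mem_univ, if_true, hubble]
  generalize a (x 0) = A at *
  generalize deriv a (x 0) = B
  generalize deriv (deriv a) (x 0) = D
  generalize i 0 = i0
  generalize i 1 = i1
  generalize i 2 = i2
  generalize i 3 = i3
  fin_cases i0 <;> fin_cases i1 <;> fin_cases i2 <;> fin_cases i3 <;>
    simp <;> field_simp <;> ring

end Curvature

/-! ### Tensors on vectors, and the Leibniz rule along curves. -/

/-- The value of a covariant tensor on a family of vectors. -/
def ev {k : ℕ} (S : CovTensor k) (x : Point) (V : Fin k → Fin 4 → ℝ) : ℝ :=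
  ∑ μ : Fin k → Fin 4, S x μ * ∏ j, V j (μ j)

lemma sum_fin_succ_pi {k : ℕ} (f : (Fin (k + 1) → Fin 4) → ℝ) :
    ∑ μ, f μ = ∑ i, ∑ μ : Fin k → Fin 4, f (Fin.cons i μ) := by
  rw [← Fintype.sum_prod_type', ← (Fin.consEquiv (fun _ => Fin 4)).sum_comp]
  rfl

lemma sum_fin_four_pi (f : (Fin 4 → Fin 4) → ℝ) :
    ∑ μ, f μ = ∑ i, ∑ j, ∑ k, ∑ l, f ![i, j, k, l] := by
  simp only [sum_fin_succ_pi, Finset.univ_unique, Finset.sum_singleton]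
  refine Finset.sum_congr rfl fun i _ => Finset.sum_congr rfl fun j _ =>
    Finset.sum_congr rfl fun k _ => Finset.sum_congr rfl fun l _ => ?_
  congr 1

lemma ev_riemann {a : ℝ → ℝ} {T : ℝ} (ha : ContDiffOn ℝ 2 a (Iio T))
    (ha_pos : ∀ t < T, 0 < a t) {x : Point} (hx : x 0 < T) (V : Fin 4 → Fin 4 → ℝ) :
    ev (riemann (flrwMetric a)) x V =
      hubble a (x 0) ^ 2 * (ip a x (V 0) (V 2) * ip a x (V 1) (V 3)
        - ip a x (V 0) (V 3) * ip a x (V 1) (V 2))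
      - deriv (hubble a) (x 0) / a (x 0) ^ 2 *
        (ell a x (V 0) * ell a x (V 2) * ip a x (V 1) (V 3)
          + ell a x (V 1) * ell a x (V 3) * ip a x (V 0) (V 2)
          - ell a x (V 0) * ell a x (V 3) * ip a x (V 1) (V 2)
          - ell a x (V 1) * ell a x (V 2) * ip a x (V 0) (V 3)) := by
  unfold ev
  simp only [riemann_flrwMetric ha ha_pos hx, ip_eq, ell, sum_fin_four_pi, Fin.prod_univ_four]
  simp only [flrwMetric, Matrix.diagonal_apply, Fin.sum_univ_four]
  generalize hubble a (x 0) ^ 2 = P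
  generalize deriv (hubble a) (x 0) / a (x 0) ^ 2 = Q
  simp
  ring

/-- Exchanging the `j`-th index with the dummy index is an involution. It moves a Christoffel symbol
from a transported vector onto the tensor. -/
lemma sum_update_swap {k : ℕ} (j : Fin k) (F : (Fin k → Fin 4) → Fin 4 → ℝ) :
    ∑ μ, ∑ β, F μ β = ∑ μ, ∑ ρ, F (Function.update μ j ρ) (μ j) := by
  rw [← Fintype.sum_prod_type', ← Fintype.sum_prod_type']
  have hinv : Function.Involutive
      (fun p : (Fin k → Fin 4) × Fin 4 => (Function.update p.1 j p.2, p.1 j)) := by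
    rintro ⟨μ, β⟩; simp
  exact (Equiv.sum_comp hinv.toPerm (fun p : (Fin k → Fin 4) × Fin 4 => F p.1 p.2)).symm

lemma fderiv_eq_sum_pderiv (f : Point → ℝ) (x v : Point) :
    fderiv ℝ f x v = ∑ α, v α * pderiv α f x := by
  conv_lhs => rw [← Finset.univ_sum_single v]
  rw [map_sum]
  refine Finset.sum_congr rfl fun α _ => ?_
  have : (Pi.single α (v α) : Point) = v α • Pi.single α 1 := by
    rw [← Pi.single_smul]; simp
  rw [this, map_smul, smul_eq_mul, pderiv]

/-- The condition for the vector `V` to be parallel, at the parameter `s`, along a curve `γ`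
with velocity `v`. -/
def ParallelAt (g : Metric) (γ : ℝ → Point) (v : Point) (s : ℝ) (V : ℝ → Fin 4 → ℝ) : Prop :=
  ∀ ρ, HasDerivAt (fun u => V u ρ) (-∑ α, ∑ β, christoffel g ρ α β (γ s) * v α * V s β) s

/-- Leibniz rule: when the arguments are parallel, their Christoffel terms are exactly those of `∇_v
S`. Only parallelism at the single parameter `s` enters. -/
lemma hasDerivAt_ev {g : Metric} {k : ℕ} {S : CovTensor k} {γ : ℝ → Point} {v : Point}
    {V : ℝ → Fin k → Fin 4 → ℝ} {s : ℝ}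
    (hS : ∀ μ, DifferentiableAt ℝ (fun y => S y μ) (γ s)) (hγ : HasDerivAt γ v s)
    (hV : ∀ j, ParallelAt g γ v s (fun u => V u j)) :
    HasDerivAt (fun u => ev S (γ u) (V u)) (ev (covDeriv g S) (γ s) (Fin.cons v (V s))) s := by
  have h1 : ∀ μ, HasDerivAt (fun u => S (γ u) μ) (∑ α, v α * pderiv α (fun y => S y μ) (γ s)) s :=
    fun μ => ((hS μ).hasFDerivAt.comp_hasDerivAt s hγ).congr_deriv (fderiv_eq_sum_pderiv _ _ _)
  have h2 : ∀ μ : Fin k → Fin 4, HasDerivAt (fun u => ∏ j, V u j (μ j)) _ s :=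
    fun μ => HasDerivAt.fun_finsetProd (u := Finset.univ) (fun j _ => hV j (μ j))
  have h3 : HasDerivAt (fun u => ev S (γ u) (V u)) _ s :=
    HasDerivAt.fun_sum (u := Finset.univ) (fun μ _ => (h1 μ).mul (h2 μ))
  refine h3.congr_deriv ?_
  unfold ev
  rw [sum_fin_succ_pi, Finset.sum_add_distrib]
  simp only [covDeriv, Fin.cons_zero, Fin.tail_cons, Fin.prod_univ_succ, Fin.cons_succ, sub_mul,
    Finset.sum_sub_distrib, smul_eq_mul]
  rw [sub_eq_add_neg]
  congr 1
  · rw [Finset.sum_comm]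
    refine Finset.sum_congr rfl fun μ _ => ?_
    rw [Finset.sum_mul]
    exact Finset.sum_congr rfl fun α _ => by ring
  · simp only [Finset.mul_sum, Finset.sum_mul, ← Finset.sum_neg_distrib]
    rw [Finset.sum_comm]
    conv_rhs =>
      enter [2, α]
      rw [Finset.sum_comm]
    rw [Finset.sum_comm (s := (Finset.univ : Finset (Fin 4)))]
    refine Finset.sum_congr rfl fun j _ => ?_
    conv_lhs =>
      enter [2, μ]
      rw [Finset.sum_comm]
    conv_lhs => enter [2, μ]; rw [Finset.sum_comm]
    rw [Finset.sum_comm]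
    refine Finset.sum_congr rfl fun α _ => ?_
    rw [sum_update_swap j]
    refine Finset.sum_congr rfl fun μ _ => Finset.sum_congr rfl fun ρ _ => ?_
    rw [Function.update_self, ← Finset.mul_prod_erase _ (fun i => V s i (μ i)) (Finset.mem_univ j)]
    have : ∏ i ∈ Finset.univ.erase j, V s i (Function.update μ j ρ i)
        = ∏ i ∈ Finset.univ.erase j, V s i (μ i) :=
      Finset.prod_congr rfl fun i hi => by rw [Function.update_of_ne (Finset.ne_of_mem_erase hi)]
    rw [this]
    ring

/-! ### Parallel transport in FLRW. -/

section Transport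

variable {a : ℝ → ℝ} {T : ℝ}

lemma parallelAt_flrwMetric (ha : ContDiffOn ℝ 2 a (Iio T)) (ha_pos : ∀ t < T, 0 < a t)
    {γ : ℝ → Point} {v : Point} {s : ℝ} {V : ℝ → Fin 4 → ℝ} (hs : γ s 0 < T) :
    ParallelAt (flrwMetric a) γ v s V ↔
      HasDerivAt (fun u => V u 0) (-(a (γ s 0) * deriv a (γ s 0) *
        (v 1 * V s 1 + v 2 * V s 2 + v 3 * V s 3))) s ∧
      ∀ i, i ≠ 0 → HasDerivAt (fun u => V u i)
        (-(deriv a (γ s 0) / a (γ s 0) * (v 0 * V s i + v i * V s 0))) s := by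
  unfold ParallelAt
  simp only [christoffel_flrwMetric ha ha_pos hs, Fin.forall_fin_succ, Fin.sum_univ_four]
  simp [flrwGamma]
  ring_nf

lemma hasDerivAt_time {γ : ℝ → Point} {v : Point} {s : ℝ} (hγ : HasDerivAt γ v s) :
    HasDerivAt (fun u => γ u 0) (v 0) s := (hasDerivAt_pi.1 hγ) 0

lemma hasDerivAt_scale_comp (ha : ContDiffOn ℝ 2 a (Iio T)) {γ : ℝ → Point} {v : Point} {s : ℝ}
    (hs : γ s 0 < T) (hγ : HasDerivAt γ v s) :
    HasDerivAt (fun u => a (γ u 0)) (deriv a (γ s 0) * v 0) s :=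
  (hasDerivAt_scale ha hs).comp s (hasDerivAt_time hγ)

/-- Metric compatibility, checked on the explicit transport equations. -/
lemma hasDerivAt_ip (ha : ContDiffOn ℝ 2 a (Iio T)) (ha_pos : ∀ t < T, 0 < a t)
    {γ : ℝ → Point} {v : Point} {s : ℝ} {V W : ℝ → Fin 4 → ℝ} (hs : γ s 0 < T)
    (hγ : HasDerivAt γ v s) (hV : ParallelAt (flrwMetric a) γ v s V)
    (hW : ParallelAt (flrwMetric a) γ v s W) :
    HasDerivAt (fun u => ip a (γ u) (V u) (W u)) 0 s := by
  obtain ⟨hV0, hV⟩ := (parallelAt_flrwMetric ha ha_pos hs).1 hV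
  obtain ⟨hW0, hW⟩ := (parallelAt_flrwMetric ha ha_pos hs).1 hW
  have h0 := (ha_pos _ hs).ne'
  simp only [ip_eq]
  refine (((hV0.mul hW0).neg).add (((hasDerivAt_scale_comp ha hs hγ).pow 2).mul
    ((((hV 1 (by decide)).mul (hW 1 (by decide))).add ((hV 2 (by decide)).mul
      (hW 2 (by decide)))).add ((hV 3 (by decide)).mul (hW 3 (by decide)))))).congr_deriv ?_
  simp only [Pi.add_apply, Pi.mul_apply, Pi.pow_apply]
  field_simp
  ring

/-- This is the identity `∇(-a dt) = ȧ g`, which makes `-a dt` integrable along null geodesics. -/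
lemma hasDerivAt_ell (ha : ContDiffOn ℝ 2 a (Iio T)) (ha_pos : ∀ t < T, 0 < a t)
    {γ : ℝ → Point} {v : Point} {s : ℝ} {V : ℝ → Fin 4 → ℝ} (hs : γ s 0 < T)
    (hγ : HasDerivAt γ v s) (hV : ParallelAt (flrwMetric a) γ v s V) :
    HasDerivAt (fun u => ell a (γ u) (V u)) (deriv a (γ s 0) * ip a (γ s) v (V s)) s := by
  obtain ⟨hV0, -⟩ := (parallelAt_flrwMetric ha ha_pos hs).1 hV
  simp only [ip_eq, ell]
  refine ((hasDerivAt_scale_comp ha hs hγ).neg.mul hV0).congr_deriv ?_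
  simp only [Pi.neg_apply]
  ring

end Transport

/-! ### A class of tensors closed under covariant differentiation. -/

/-- On `t < T₁`, the values of `S` are smooth functions of the scale factor `a ∈ U`, of the values
of the covector `-a dt`, and of the inner products of the vectors. -/
def IsScaleTensor (a : ℝ → ℝ) (T₁ : ℝ) (U : Set ℝ) {k : ℕ} (S : CovTensor k) : Prop :=
  ∃ Φ : ℝ × (Fin k → ℝ) × (Fin k → Fin k → ℝ) → ℝ,
    ContDiffOn ℝ ∞ Φ (U ×ˢ univ) ∧ ∀ x : Point, x 0 < T₁ → ∀ V : Fin k → Fin 4 → ℝ,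
      ev S x V = Φ (a (x 0), fun i => ell a x (V i), fun i j => ip a x (V i) (V j))

lemma ev_single {k : ℕ} (S : CovTensor k) (x : Point) (μ : Fin k → Fin 4) :
    ev S x (fun j => Pi.single (μ j) 1) = S x μ := by
  unfold ev
  rw [Finset.sum_eq_single μ]
  · simp
  · intro ν _ hν
    obtain ⟨j, hj⟩ := Function.ne_iff.1 hν
    rw [Finset.prod_eq_zero (Finset.mem_univ j) (by simp [hj]), mul_zero]
  · simp

/-- A straight line and vectors affine in the parameter suffice, because the transport equation is
needed only at parameter `0`; no differential equation is solved. -/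
lemma exists_hasDerivAt_parallelAt (g : Metric) {k : ℕ} (x v : Point) (V : Fin k → Fin 4 → ℝ) :
    ∃ (γ : ℝ → Point) (W : ℝ → Fin k → Fin 4 → ℝ), γ 0 = x ∧ W 0 = V ∧ HasDerivAt γ v 0 ∧
      ∀ j, ParallelAt g γ v 0 (fun u => W u j) := by
  refine ⟨fun u => x + u • v, fun u j ρ => V j ρ + u * (-∑ α, ∑ β,
    christoffel g ρ α β x * v α * V j β), by simp, by simp, ?_, ?_⟩
  · simpa using ((hasDerivAt_id (0 : ℝ)).smul_const v).const_add x
  · intro j ρ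
    simpa using ((hasDerivAt_id (0 : ℝ)).mul_const
      (-∑ α, ∑ β, christoffel g ρ α β x * v α * V j β)).const_add (V j ρ)

section

variable {a h : ℝ → ℝ} {T T₁ : ℝ} {U : Set ℝ}

lemma IsScaleTensor.differentiableAt {k : ℕ} {S : CovTensor k} (hS : IsScaleTensor a T₁ U S)
    (ha : ContDiffOn ℝ 2 a (Iio T)) (hT : T₁ ≤ T) (hU : IsOpen U) (haU : ∀ t < T₁, a t ∈ U)
    {x : Point} (hx : x 0 < T₁) (μ : Fin k → Fin 4) :
    DifferentiableAt ℝ (fun y => S y μ) x := by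
  obtain ⟨Φ, hΦ, hSΦ⟩ := hS
  have hda : DifferentiableAt ℝ (fun y : Point => a (y 0)) x :=
    DifferentiableAt.comp x (hasDerivAt_scale ha (hx.trans_le hT)).differentiableAt
      (differentiableAt_apply 0 x)
  have hin : DifferentiableAt ℝ (fun y : Point => (a (y 0),
      (fun i => ell a y (Pi.single (μ i) 1) : Fin k → ℝ),
      (fun i j => ip a y (Pi.single (μ i) 1) (Pi.single (μ j) 1) : Fin k → Fin k → ℝ))) x := by
    simp only [ip_eq, ell]
    refine hda.prodMk (DifferentiableAt.prodMk ?_ ?_)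
    · exact differentiableAt_pi.2 fun i => hda.neg.mul_const _
    · exact differentiableAt_pi.2 fun i => differentiableAt_pi.2 fun j =>
        ((hda.pow 2).mul_const _).const_add _
  have hΦx := (hΦ.contDiffAt ((hU.prod isOpen_univ).mem_nhds
    (show (a (x 0), (fun i => ell a x (Pi.single (μ i) 1) : Fin k → ℝ),
      (fun i j => ip a x (Pi.single (μ i) 1) (Pi.single (μ j) 1) : Fin k → Fin k → ℝ)) ∈ _
      from ⟨haU _ hx, mem_univ _⟩))).differentiableAt (by simp)
  refine (hΦx.comp x hin).congr_of_eventuallyEq ?_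
  filter_upwards [eventually_time_lt hx] with y hy
  rw [← ev_single S y μ, hSΦ y hy]
  rfl

/-- Chain rule: along a direction `v`, the derivatives of `a`, of `ℓ` on a parallel vector and of
inner products of parallel vectors are again smooth expressions in `a`, `ℓ` and inner products. -/
lemma IsScaleTensor.covDeriv {k : ℕ} {S : CovTensor k} (hS : IsScaleTensor a T₁ U S)
    (ha : ContDiffOn ℝ 2 a (Iio T)) (ha_pos : ∀ t < T, 0 < a t) (hT : T₁ ≤ T) (hU : IsOpen U)
    (haU : ∀ t < T₁, a t ∈ U) (hh : ContDiffOn ℝ ∞ h U)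
    (hda : ∀ t < T₁, deriv a t = a t * h (a t)) :
    IsScaleTensor a T₁ U (covDeriv (flrwMetric a) S) := by
  have hdiff := fun x hx μ => hS.differentiableAt ha hT hU haU (x := x) hx μ
  obtain ⟨Φ, hΦ, hSΦ⟩ := hS
  have hUo := hU.prod (isOpen_univ (X := (Fin k → ℝ) × (Fin k → Fin k → ℝ)))
  let P : ℝ × (Fin (k + 1) → ℝ) × (Fin (k + 1) → Fin (k + 1) → ℝ) →
      ℝ × (Fin k → ℝ) × (Fin k → Fin k → ℝ) :=
    fun p => (p.1, fun i => p.2.1 i.succ, fun i j => p.2.2 i.succ j.succ)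
  -- The velocity of the data along the first argument `v`: `ȧ v⁰ = -h(a) ℓ(v)`, then `ȧ g(v, V) = a
  -- h(a) g(v, V)`, then `0`.
  let Q : ℝ × (Fin (k + 1) → ℝ) × (Fin (k + 1) → Fin (k + 1) → ℝ) →
      ℝ × (Fin k → ℝ) × (Fin k → Fin k → ℝ) :=
    fun p => (-(h p.1 * p.2.1 0), fun i => p.1 * h p.1 * p.2.2 0 i.succ, 0)
  refine ⟨fun p => fderiv ℝ Φ (P p) (Q p), ?_, ?_⟩
  · have hP : ContDiff ℝ ∞ P := by fun_prop
    have hh1 : ContDiffOn ℝ ∞ (fun p : ℝ × (Fin (k + 1) → ℝ) × (Fin (k + 1) → Fin (k + 1) → ℝ) =>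
        h p.1) (U ×ˢ univ) := hh.comp contDiff_fst.contDiffOn (fun p hp => hp.1)
    have hQ : ContDiffOn ℝ ∞ Q (U ×ˢ univ) := by
      refine (hh1.mul (ContDiff.contDiffOn (by fun_prop))).neg.prodMk
        (ContDiffOn.prodMk (contDiffOn_pi.2 fun i => ?_) contDiffOn_const)
      exact (contDiff_fst.contDiffOn.mul hh1).mul (ContDiff.contDiffOn (by fun_prop))
    have hΦ' : ContDiffOn ℝ ∞ (fderiv ℝ Φ) (U ×ˢ univ) :=
      hΦ.fderiv_of_isOpen hUo (by simp)
    exact (hΦ'.comp hP.contDiffOn (fun p hp => ⟨hp.1, mem_univ _⟩)).clm_apply hQ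
  · intro x hx V
    obtain ⟨γ, W, hγ0, hW0, hγ, hW⟩ :=
      exists_hasDerivAt_parallelAt (flrwMetric a) x (V 0) (Fin.tail V)
    subst hγ0
    have hxT := hx.trans_le hT
    have e1 := hasDerivAt_ev (S := S) (fun μ => hdiff _ hx μ) hγ hW
    rw [hW0, Fin.cons_self_tail] at e1
    have hin : HasDerivAt (fun u => (a (γ u 0), (fun i => ell a (γ u) (W u i) : Fin k → ℝ),
        (fun i j => ip a (γ u) (W u i) (W u j) : Fin k → Fin k → ℝ)))
        (Q (a (γ 0 0), fun i => ell a (γ 0) (V i), fun i j => ip a (γ 0) (V i) (V j))) 0 := by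
      refine HasDerivAt.prodMk ?_ (HasDerivAt.prodMk ?_ ?_)
      · refine (hasDerivAt_scale_comp ha hxT hγ).congr_deriv ?_
        simp only [hda _ hx, ell]; ring
      · rw [hasDerivAt_pi]
        intro i
        refine (hasDerivAt_ell ha ha_pos hxT hγ (hW i)).congr_deriv ?_
        rw [hda _ hx, hW0]; rfl
      · rw [hasDerivAt_pi]
        intro i
        rw [hasDerivAt_pi]
        exact fun j => hasDerivAt_ip ha ha_pos hxT hγ (hW i) (hW j)
    have hmem : (a (γ 0 0), (fun i => ell a (γ 0) (W 0 i) : Fin k → ℝ),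
        (fun i j => ip a (γ 0) (W 0 i) (W 0 j) : Fin k → Fin k → ℝ)) ∈ U ×ˢ univ :=
      ⟨haU _ hx, mem_univ _⟩
    have hΦx := ((hΦ.contDiffAt (hUo.mem_nhds hmem)).differentiableAt (by simp)).hasFDerivAt
    have e2 := hΦx.comp_hasDerivAt 0 hin
    have e3 := e2.congr_of_eventuallyEq (f₁ := fun u => ev S (γ u) (W u)) (by
      filter_upwards [hγ.continuousAt.eventually (eventually_time_lt hx)] with u hu
      exact hSΦ _ hu _)
    -- Both formulas differentiate the same function at `0`: one by the Leibniz rule, the other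
    -- through `Φ`.
    rw [e1.unique e3, hW0]
    rfl

lemma isScaleTensor_riemann {G : ℝ → ℝ} (ha : ContDiffOn ℝ 2 a (Iio T))
    (ha_pos : ∀ t < T, 0 < a t) (hT : T₁ ≤ T)
    (hh : ContDiffOn ℝ ∞ h U) (hG : ContDiffOn ℝ ∞ G U)
    (hda : ∀ t < T₁, deriv a t = a t * h (a t))
    (hH : ∀ t < T₁, deriv (hubble a) t / a t ^ 2 = G (a t)) :
    IsScaleTensor a T₁ U (riemann (flrwMetric a)) := by
  refine ⟨fun p => h p.1 ^ 2 * (p.2.2 0 2 * p.2.2 1 3 - p.2.2 0 3 * p.2.2 1 2) - G p.1 *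
    (p.2.1 0 * p.2.1 2 * p.2.2 1 3 + p.2.1 1 * p.2.1 3 * p.2.2 0 2
      - p.2.1 0 * p.2.1 3 * p.2.2 1 2 - p.2.1 1 * p.2.1 2 * p.2.2 0 3), ?_, ?_⟩
  · have hh1 : ContDiffOn ℝ ∞ (fun p : ℝ × (Fin 4 → ℝ) × (Fin 4 → Fin 4 → ℝ) =>
        h p.1) (U ×ˢ univ) := hh.comp contDiff_fst.contDiffOn (fun p hp => hp.1)
    have hG1 : ContDiffOn ℝ ∞ (fun p : ℝ × (Fin 4 → ℝ) × (Fin 4 → Fin 4 → ℝ) =>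
        G p.1) (U ×ˢ univ) := hG.comp contDiff_fst.contDiffOn (fun p hp => hp.1)
    exact ((hh1.pow 2).mul (ContDiff.contDiffOn (by fun_prop))).sub
      (hG1.mul (ContDiff.contDiffOn (by fun_prop)))
  · intro x hx V
    have h0 := (ha_pos _ (hx.trans_le hT)).ne'
    rw [ev_riemann ha ha_pos (hx.trans_le hT), hH _ hx]
    have : hubble a (x 0) = h (a (x 0)) := by
      rw [hubble, hda _ hx]; field_simp
    rw [this]

lemma isScaleTensor_iterCovDerivRiemann {G : ℝ → ℝ} (ha : ContDiffOn ℝ 2 a (Iio T))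
    (ha_pos : ∀ t < T, 0 < a t) (hT : T₁ ≤ T) (hU : IsOpen U) (haU : ∀ t < T₁, a t ∈ U)
    (hh : ContDiffOn ℝ ∞ h U) (hG : ContDiffOn ℝ ∞ G U)
    (hda : ∀ t < T₁, deriv a t = a t * h (a t))
    (hH : ∀ t < T₁, deriv (hubble a) t / a t ^ 2 = G (a t)) (r : ℕ) :
    IsScaleTensor a T₁ U (iterCovDerivRiemann (flrwMetric a) r) := by
  induction r with
  | zero => exact isScaleTensor_riemann ha ha_pos hT hh hG hda hH
  | succ r ih => exact ih.covDeriv ha ha_pos hT hU haU hh hda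

end

/-! ### Limits of the tetrad components of `-a dt`. -/

lemma exists_eq_const_of_hasDerivAt_zero {f : ℝ → ℝ} {s : Set ℝ} (hs : IsOpen s)
    (hs' : IsPreconnected s) (hf : ∀ x ∈ s, HasDerivAt f 0 x) : ∃ c, ∀ x ∈ s, f x = c :=
  hs.exists_is_const_of_deriv_eq_zero hs'
    (fun x hx => (hf x hx).differentiableAt.differentiableWithinAt) (fun x hx => (hf x hx).deriv)

/-- The Minkowski metric. -/
def mink (m n : Fin 4) : ℝ := if m = n then (if m = 0 then -1 else 1) else 0

section

variable {a : ℝ → ℝ} {T δ : ℝ} {γ k : ℝ → Point} {E : ℝ → Fin 4 → Fin 4 → ℝ}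

/-- Orthonormality exhibits a left inverse of the transposed frame matrix; for square matrices it is
also a right inverse, which is the expansion. -/
lemma eq_sum_of_orthonormal {x : Point} {e : Fin 4 → Fin 4 → ℝ}
    (he : ∀ m n, ip a x (e m) (e n) = mink m n) (v : Fin 4 → ℝ) (α : Fin 4) :
    v α = ∑ m, mink m m * ip a x (e m) v * e m α := by
  let A : Matrix (Fin 4) (Fin 4) ℝ := Matrix.of e
  let N : Matrix (Fin 4) (Fin 4) ℝ := Matrix.diagonal fun m => mink m m
  have h1 : (N * (A * flrwMetric a x)) * A.transpose = 1 := by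
    have h2 : A * flrwMetric a x * A.transpose = N := by
      ext m n
      have := he m n
      simp only [ip] at this
      rw [Finset.sum_comm] at this
      simp only [Matrix.mul_apply, Matrix.transpose_apply, A, Matrix.of_apply, Finset.sum_mul]
      simp only [N, Matrix.diagonal_apply]
      have hN : (if m = n then mink m m else 0) = mink m n := by
        split_ifs with h
        · rw [h]
        · simp [mink, h]
      rw [hN, ← this]
      exact Finset.sum_congr rfl fun _ _ => Finset.sum_congr rfl fun _ _ => by ring
    rw [Matrix.mul_assoc, h2, Matrix.diagonal_mul_diagonal, ← Matrix.diagonal_one]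
    congr 1
    ext m
    simp only [mink, if_true]
    split_ifs <;> norm_num
  have h3 := mul_eq_one_comm.1 h1
  have h4 : (A.transpose * (N * (A * flrwMetric a x))).mulVec v α = v α := by
    rw [h3, Matrix.one_mulVec]
  rw [← h4]
  simp only [← Matrix.mulVec_mulVec]
  simp only [Matrix.mulVec, dotProduct, Matrix.transpose_apply, A, Matrix.of_apply, ip, N,
    Matrix.diagonal_apply, ite_mul, zero_mul, Finset.sum_ite_eq, Finset.mem_univ, if_true]
  refine Finset.sum_congr rfl fun m _ => ?_
  have : ∑ i, e m i * ∑ j, flrwMetric a x i j * v j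
      = ∑ α, ∑ β, flrwMetric a x α β * e m α * v β := by
    refine Finset.sum_congr rfl fun _ _ => ?_
    rw [Finset.mul_sum]
    exact Finset.sum_congr rfl fun _ _ => by ring
  rw [this]
  ring

lemma ell_eq_sum_of_orthonormal {x : Point} {e : Fin 4 → Fin 4 → ℝ}
    (he : ∀ m n, ip a x (e m) (e n) = mink m n) (v : Fin 4 → ℝ) :
    ell a x v = ∑ m, mink m m * ip a x (e m) v * ell a x (e m) := by
  unfold ell
  rw [eq_sum_of_orthonormal he v 0, Finset.mul_sum]
  exact Finset.sum_congr rfl fun _ _ => by ring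

/-- The frame expression of the squared norm of `-a dt`, read off from the expansion of `∂_t`. -/
lemma sum_ell_sq_of_orthonormal {x : Point} {e : Fin 4 → Fin 4 → ℝ}
    (he : ∀ m n, ip a x (e m) (e n) = mink m n) :
    ∑ m, mink m m * ell a x (e m) ^ 2 = -a (x 0) ^ 2 := by
  have h := eq_sum_of_orthonormal he (Pi.single 0 1) 0
  simp only [ip_eq, Fin.sum_univ_four] at h
  simp at h
  simp only [ell, Fin.sum_univ_four]
  linear_combination (a (x 0)) ^ 2 * h

lemma IsNullGeodesicFromPast.parallelAt (hγ : IsNullGeodesicFromPast a T δ γ k) {s : ℝ}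
    (hs : s ∈ Ioo 0 δ) : ParallelAt (flrwMetric a) γ (k s) s k := hγ.geodesic s hs

lemma IsPPTetrad.parallelAt (hE : IsPPTetrad a δ γ k E) {s : ℝ}
    (hs : s ∈ Ioo 0 δ) (m : Fin 4) :
    ParallelAt (flrwMetric a) γ (k s) s (fun u => E u m) := hE.parallel s hs m

lemma ip_comm (x : Point) (v w : Fin 4 → ℝ) : ip a x v w = ip a x w v := by
  rw [ip_eq, ip_eq]; ring

lemma IsPPTetrad.ip_eq_mink (hE : IsPPTetrad a δ γ k E) {s : ℝ} (hs : s ∈ Ioo 0 δ)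
    (m n : Fin 4) : ip a (γ s) (E s m) (E s n) = mink m n := hE.orthonormal s hs m n

/-- The derivative of `ℓ(k)` is `ȧ g(k, k) = 0`. If the constant vanished, then `k⁰ = 0`, and
nullness would force `k = 0`. -/
lemma IsNullGeodesicFromPast.exists_ell_eq (hγ : IsNullGeodesicFromPast a T δ γ k)
    (ha : ContDiffOn ℝ 2 a (Iio T)) (ha_pos : ∀ t < T, 0 < a t) :
    ∃ c, c ≠ 0 ∧ ∀ s ∈ Ioo 0 δ, ell a (γ s) (k s) = c := by
  obtain ⟨c, hc⟩ := exists_eq_const_of_hasDerivAt_zero (f := fun s => ell a (γ s) (k s))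
    isOpen_Ioo isPreconnected_Ioo (fun s hs => by
      refine (hasDerivAt_ell ha ha_pos (hγ.mem s hs) (hγ.tangent s hs)
        (hγ.parallelAt hs)).congr_deriv ?_
      have : ip a (γ s) (k s) (k s) = 0 := hγ.null s hs
      rw [this, mul_zero])
  refine ⟨c, ?_, hc⟩
  rintro rfl
  have hs : δ / 2 ∈ Ioo 0 δ := ⟨half_pos hγ.pos, half_lt_self hγ.pos⟩
  have h1 := hc _ hs
  have h0 := ha_pos _ (hγ.mem _ hs)
  have hk0 : k (δ / 2) 0 = 0 := by
    simpa [ell, h0.ne'] using h1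
  have h2 : ip a (γ (δ / 2)) (k (δ / 2)) (k (δ / 2)) = 0 := hγ.null _ hs
  rw [ip_eq, hk0] at h2
  have h3 : k (δ / 2) 1 * k (δ / 2) 1 + k (δ / 2) 2 * k (δ / 2) 2
      + k (δ / 2) 3 * k (δ / 2) 3 = 0 := by
    have := (pow_pos h0 2).ne'
    simpa [this] using h2
  refine hγ.ne_zero _ hs ?_
  ext i
  fin_cases i
  · exact hk0
  · change k (δ / 2) 1 = 0
    nlinarith [mul_self_nonneg (k (δ / 2) 1), mul_self_nonneg (k (δ / 2) 2),
      mul_self_nonneg (k (δ / 2) 3)]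
  · change k (δ / 2) 2 = 0
    nlinarith [mul_self_nonneg (k (δ / 2) 1), mul_self_nonneg (k (δ / 2) 2),
      mul_self_nonneg (k (δ / 2) 3)]
  · change k (δ / 2) 3 = 0
    nlinarith [mul_self_nonneg (k (δ / 2) 1), mul_self_nonneg (k (δ / 2) 2),
      mul_self_nonneg (k (δ / 2) 3)]

lemma Ioo_mem_nhdsGT_zero (hδ : 0 < δ) : ∀ᶠ s in 𝓝[>] (0 : ℝ), s ∈ Ioo 0 δ :=
  Ioo_mem_nhdsGT hδ

/-- Along a null geodesic from the past boundary, the components of `-a dt` with respect to a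
parallelly propagated tetrad converge to those of a nonzero null covector. -/
lemma IsNullGeodesicFromPast.exists_tendsto_ell (hγ : IsNullGeodesicFromPast a T δ γ k)
    (hE : IsPPTetrad a δ γ k E)
    (ha : ContDiffOn ℝ 2 a (Iio T)) (ha_pos : ∀ t < T, 0 < a t)
    (ha_lim : Tendsto a atBot (𝓝 0)) :
    ∃ μ : Fin 4 → ℝ, (∀ m, Tendsto (fun s => ell a (γ s) (E s m)) (𝓝[>] 0) (𝓝 (μ m))) ∧
      μ 0 ≠ 0 ∧ μ 0 ^ 2 = μ 1 ^ 2 + μ 2 ^ 2 + μ 3 ^ 2 := by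
  obtain ⟨c, hc0, hc⟩ := hγ.exists_ell_eq ha ha_pos
  have hκ : ∀ m, ∃ κ, ∀ s ∈ Ioo 0 δ, ip a (γ s) (k s) (E s m) = κ := fun m =>
    exists_eq_const_of_hasDerivAt_zero (f := fun s => ip a (γ s) (k s) (E s m))
      isOpen_Ioo isPreconnected_Ioo fun s hs => hasDerivAt_ip ha ha_pos (hγ.mem s hs)
        (hγ.tangent s hs) (hγ.parallelAt hs) (hE.parallelAt hs m)
  choose κ hκ using hκ
  -- With `κ = g(k, E_m)`, the derivative of `ℓ(E_m)` is `ȧ κ`. As `a k⁰ = -c`, it cancels against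
  -- the derivative of `κ a²/(2c)`, so the sum is a first integral.
  have hμ : ∀ m, ∃ μ, ∀ s ∈ Ioo 0 δ,
      ell a (γ s) (E s m) + κ m / (2 * c) * a (γ s 0) ^ 2 = μ := fun m => by
    refine exists_eq_const_of_hasDerivAt_zero isOpen_Ioo isPreconnected_Ioo fun s hs => ?_
    refine ((hasDerivAt_ell ha ha_pos (hγ.mem s hs) (hγ.tangent s hs)
      (hE.parallelAt hs m)).add (((hasDerivAt_scale_comp ha (hγ.mem s hs)
      (hγ.tangent s hs)).pow 2).const_mul (κ m / (2 * c)))).congr_deriv ?_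
    rw [hκ m s hs]
    have := hc s hs
    unfold ell at this
    push_cast
    field_simp
    linear_combination (-deriv a (γ s 0) * κ m) * this
  choose μ hμ using hμ
  have ha0 : Tendsto (fun s => a (γ s 0)) (𝓝[>] 0) (𝓝 0) := ha_lim.comp hγ.toBoundary
  have hlim : ∀ m, Tendsto (fun s => ell a (γ s) (E s m)) (𝓝[>] 0) (𝓝 (μ m)) := fun m => by
    have h1 : Tendsto (fun s => μ m - κ m / (2 * c) * a (γ s 0) ^ 2) (𝓝[>] 0) (𝓝 (μ m)) := by
      simpa using ((ha0.pow 2).const_mul (κ m / (2 * c))).const_sub (μ m)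
    refine h1.congr' ?_
    filter_upwards [Ioo_mem_nhdsGT_zero hγ.pos] with s hs
    rw [← hμ m s hs]; ring
  have hnull : μ 0 ^ 2 = μ 1 ^ 2 + μ 2 ^ 2 + μ 3 ^ 2 := by
    have h1 : Tendsto (fun s => ∑ m, mink m m * ell a (γ s) (E s m) ^ 2) (𝓝[>] 0)
        (𝓝 (∑ m, mink m m * μ m ^ 2)) :=
      tendsto_finsetSum _ fun m _ => ((hlim m).pow 2).const_mul _
    have h2 : Tendsto (fun s => ∑ m, mink m m * ell a (γ s) (E s m) ^ 2) (𝓝[>] 0) (𝓝 0) := by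
      have : Tendsto (fun s => -a (γ s 0) ^ 2) (𝓝[>] 0) (𝓝 0) := by
        simpa using (ha0.pow 2).neg
      refine this.congr' ?_
      filter_upwards [Ioo_mem_nhdsGT_zero hγ.pos] with s hs
      exact (sum_ell_sq_of_orthonormal (hE.ip_eq_mink hs)).symm
    have h3 := tendsto_nhds_unique h1 h2
    simp [Fin.sum_univ_four, mink] at h3
    linarith
  refine ⟨μ, hlim, fun h0 => hc0 ?_, hnull⟩
  -- If `μ 0 = 0`, nullness makes every limit zero. But `ℓ(k) = c` is a combination of the
  -- components with the constant coefficients `κ`, so `c` would be zero.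
  have h1 : Tendsto (fun s => ∑ m, mink m m * κ m * ell a (γ s) (E s m)) (𝓝[>] 0)
      (𝓝 (∑ m, mink m m * κ m * μ m)) :=
    tendsto_finsetSum _ fun m _ => (hlim m).const_mul _
  have h2 : Tendsto (fun s => ∑ m, mink m m * κ m * ell a (γ s) (E s m)) (𝓝[>] 0) (𝓝 c) := by
    refine tendsto_const_nhds.congr' ?_
    filter_upwards [Ioo_mem_nhdsGT_zero hγ.pos] with s hs
    rw [← hc s hs, ell_eq_sum_of_orthonormal (hE.ip_eq_mink hs)]
    exact Finset.sum_congr rfl fun m _ => by rw [ip_comm, hκ m s hs]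
  have hz : ∀ m, μ m = 0 := by
    rw [h0] at hnull
    intro m
    fin_cases m
    · exact h0
    · change μ 1 = 0; nlinarith [sq_nonneg (μ 1), sq_nonneg (μ 2), sq_nonneg (μ 3)]
    · change μ 2 = 0; nlinarith [sq_nonneg (μ 1), sq_nonneg (μ 2), sq_nonneg (μ 3)]
    · change μ 3 = 0; nlinarith [sq_nonneg (μ 1), sq_nonneg (μ 2), sq_nonneg (μ 3)]
  rw [← tendsto_nhds_unique h1 h2]
  simp [hz]

end

/-! ### Behaviour of curvature components at the boundary. -/

section

variable {a : ℝ → ℝ} {T δ : ℝ} {γ k : ℝ → Point} {E : ℝ → Fin 4 → Fin 4 → ℝ}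

/-- A tensor field whose values are smooth functions of the scale factor up to `a = 0` has
convergent components. -/
lemma IsScaleTensor.exists_tendsto {T₁ : ℝ} {U : Set ℝ} {n : ℕ} {S : CovTensor n}
    (hS : IsScaleTensor a T₁ U S) (hU : IsOpen U) (h0 : (0 : ℝ) ∈ U)
    (hγ : IsNullGeodesicFromPast a T δ γ k) (hE : IsPPTetrad a δ γ k E)
    (ha : ContDiffOn ℝ 2 a (Iio T)) (ha_pos : ∀ t < T, 0 < a t)
    (ha_lim : Tendsto a atBot (𝓝 0)) (m : Fin n → Fin 4) :
    ∃ L, Tendsto (fun s => ev S (γ s) (fun j => E s (m j))) (𝓝[>] 0) (𝓝 L) := by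
  obtain ⟨μ, hμ, -⟩ := hγ.exists_tendsto_ell hE ha ha_pos ha_lim
  obtain ⟨Φ, hΦ, hSΦ⟩ := hS
  let p : ℝ × (Fin n → ℝ) × (Fin n → Fin n → ℝ) :=
    (0, fun i => μ (m i), fun i j => mink (m i) (m j))
  have hc : ContinuousAt Φ p :=
    (hΦ.contDiffAt ((hU.prod isOpen_univ).mem_nhds (show p ∈ U ×ˢ univ from ⟨h0, mem_univ _⟩))).continuousAt
  have hin : Tendsto (fun s => (a (γ s 0), (fun i => ell a (γ s) (E s (m i)) : Fin n → ℝ),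
      (fun i j => ip a (γ s) (E s (m i)) (E s (m j)) : Fin n → Fin n → ℝ))) (𝓝[>] 0) (𝓝 p) := by
    refine (ha_lim.comp hγ.toBoundary).prodMk_nhds (Tendsto.prodMk_nhds ?_ ?_)
    · exact tendsto_pi_nhds.2 fun i => hμ _
    · refine tendsto_pi_nhds.2 fun i => tendsto_pi_nhds.2 fun j => tendsto_const_nhds.congr' ?_
      filter_upwards [Ioo_mem_nhdsGT_zero hγ.pos] with s hs
      exact (hE.ip_eq_mink hs _ _).symm
  refine ⟨Φ p, (hc.tendsto.comp hin).congr' ?_⟩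
  filter_upwards [hγ.toBoundary.eventually (eventually_lt_atBot T₁)] with s hs
  exact (hSΦ _ hs _).symm

lemma ppComponent_zero (hγ : IsNullGeodesicFromPast a T δ γ k) (hE : IsPPTetrad a δ γ k E)
    (ha : ContDiffOn ℝ 2 a (Iio T)) (ha_pos : ∀ t < T, 0 < a t) (m : Fin 4 → Fin 4) {s : ℝ}
    (hs : s ∈ Ioo 0 δ) :
    ppComponent a 0 γ E m s =
      hubble a (γ s 0) ^ 2 * (mink (m 0) (m 2) * mink (m 1) (m 3)
        - mink (m 0) (m 3) * mink (m 1) (m 2))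
      - deriv (hubble a) (γ s 0) / a (γ s 0) ^ 2 *
        (ell a (γ s) (E s (m 0)) * ell a (γ s) (E s (m 2)) * mink (m 1) (m 3)
          + ell a (γ s) (E s (m 1)) * ell a (γ s) (E s (m 3)) * mink (m 0) (m 2)
          - ell a (γ s) (E s (m 0)) * ell a (γ s) (E s (m 3)) * mink (m 1) (m 2)
          - ell a (γ s) (E s (m 1)) * ell a (γ s) (E s (m 2)) * mink (m 0) (m 3)) := by
  have h := ev_riemann ha ha_pos (hγ.mem s hs) (fun j => E s (m j))
  simp only [hE.ip_eq_mink hs] at h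
  exact h

lemma isExtendible_zero {X Y : ℝ} (ha : ContDiffOn ℝ 2 a (Iio T)) (ha_pos : ∀ t < T, 0 < a t)
    (ha_lim : Tendsto a atBot (𝓝 0)) (hX : Tendsto (hubble a) atBot (𝓝 X))
    (hY : Tendsto (fun t => deriv (hubble a) t / a t ^ 2) atBot (𝓝 Y)) :
    IsExtendible a T 0 := by
  rintro ⟨δ, γ, k, E, hγ, hE, m, hm⟩
  obtain ⟨μ, hμ, -⟩ := hγ.exists_tendsto_ell hE ha ha_pos ha_lim
  have hX' := hX.comp hγ.toBoundary
  have hY' := hY.comp hγ.toBoundary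
  refine hm ⟨_, Tendsto.congr' ?_ (((hX'.pow 2).mul_const (mink (m 0) (m 2) * mink (m 1) (m 3)
        - mink (m 0) (m 3) * mink (m 1) (m 2))).sub (hY'.mul
      (((((hμ (m 0)).mul (hμ (m 2))).mul_const (mink (m 1) (m 3))).add
        (((hμ (m 1)).mul (hμ (m 3))).mul_const (mink (m 0) (m 2)))).sub
        (((hμ (m 0)).mul (hμ (m 3))).mul_const (mink (m 1) (m 2))) |>.sub
        (((hμ (m 1)).mul (hμ (m 2))).mul_const (mink (m 0) (m 3))))))⟩
  filter_upwards [Ioo_mem_nhdsGT_zero hγ.pos] with s hs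
  exact (ppComponent_zero hγ hE ha ha_pos m hs).symm

/-- The `0b0b` component is `-H² - (Ḣ/a²)(ℓ₀² - ℓ_b²)`. The first term stays bounded, and the
bracket has a nonzero limit for a suitable spatial `b`. -/
lemma exists_tendsto_abs_ppComponent {X : ℝ} (hγ : IsNullGeodesicFromPast a T δ γ k)
    (hE : IsPPTetrad a δ γ k E) (ha : ContDiffOn ℝ 2 a (Iio T)) (ha_pos : ∀ t < T, 0 < a t)
    (ha_lim : Tendsto a atBot (𝓝 0)) (hX : Tendsto (hubble a) atBot (𝓝 X))
    (hY : Tendsto (fun t => |deriv (hubble a) t / a t ^ 2|) atBot atTop) :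
    ∃ m, Tendsto (fun s => |ppComponent a 0 γ E m s|) (𝓝[>] 0) atTop := by
  obtain ⟨μ, hμ, hμ0, hnull⟩ := hγ.exists_tendsto_ell hE ha ha_pos ha_lim
  -- Otherwise each spatial `μ b ^ 2` equals `μ 0 ^ 2`, and nullness gives `μ 0 ^ 2 = 3 * μ 0 ^ 2`.
  obtain ⟨b, hb0, hb⟩ : ∃ b : Fin 4, b ≠ 0 ∧ μ 0 ^ 2 - μ b ^ 2 ≠ 0 := by
    by_contra! hcon
    have h1 := hcon 1 (by decide)
    have h2 := hcon 2 (by decide)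
    have h3 := hcon 3 (by decide)
    exact hμ0 (pow_eq_zero_iff (n := 2) (by norm_num) |>.1 (by linarith))
  have hX' := ((hX.comp hγ.toBoundary).pow 2).abs
  have hY' := hY.comp hγ.toBoundary
  have hcoef := (((hμ 0).pow 2).sub ((hμ b).pow 2)).abs
  have hmain := (hY'.atTop_mul_pos (abs_pos.2 hb) hcoef).atTop_add hX'.neg
  refine ⟨![0, b, 0, b], tendsto_atTop_mono' _ ?_ hmain⟩
  filter_upwards [Ioo_mem_nhdsGT_zero hγ.pos] with s hs
  rw [ppComponent_zero hγ hE ha ha_pos _ hs]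
  have e0 : (![0, b, 0, b] : Fin 4 → Fin 4) 0 = 0 := rfl
  have e1 : (![0, b, 0, b] : Fin 4 → Fin 4) 1 = b := rfl
  have e2 : (![0, b, 0, b] : Fin 4 → Fin 4) 2 = 0 := rfl
  have e3 : (![0, b, 0, b] : Fin 4 → Fin 4) 3 = b := rfl
  rw [e0, e1, e2, e3]
  simp only [mink, hb0, hb0.symm, if_true, if_false, Function.comp]
  rw [← abs_mul]
  have := abs_add_le (-(hubble a (γ s 0) ^ 2) - deriv (hubble a) (γ s 0) / a (γ s 0) ^ 2 *
    (ell a (γ s) (E s 0) ^ 2 - ell a (γ s) (E s b) ^ 2)) (hubble a (γ s 0) ^ 2)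
  rw [← abs_neg] at this
  ring_nf at this ⊢
  linarith

lemma isPPCurvatureSingularity_zero {X : ℝ} (hB : HasPastBoundary a T)
    (ha : ContDiffOn ℝ 2 a (Iio T)) (ha_pos : ∀ t < T, 0 < a t)
    (ha_lim : Tendsto a atBot (𝓝 0)) (hX : Tendsto (hubble a) atBot (𝓝 X))
    (hY : Tendsto (fun t => |deriv (hubble a) t / a t ^ 2|) atBot atTop) :
    IsPPCurvatureSingularity a T 0 := by
  obtain ⟨δ, γ, k, E, hγ, hE⟩ := hB
  obtain ⟨m, hm⟩ := exists_tendsto_abs_ppComponent hγ hE ha ha_pos ha_lim hX hY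
  exact ⟨δ, γ, k, E, hγ, hE, m, fun ⟨L, hL⟩ => not_tendsto_nhds_of_tendsto_atTop hm _ hL.abs⟩

end

/-! ### Construction of a null geodesic with a p.p. tetrad. -/

/-- Both `f + g` and `g - f` are monotone. Writing `f + g = 2g - (g - f)` bounds the former below,
so it converges in the past, and so does `f`. -/
lemma exists_tendsto_atBot_of_abs_deriv_le {f f' g g' : ℝ → ℝ} {t₁ l : ℝ}
    (hf : ∀ t < t₁, HasDerivAt f (f' t) t) (hg : ∀ t < t₁, HasDerivAt g (g' t) t)
    (hle : ∀ t < t₁, |f' t| ≤ g' t) (hgl : Tendsto g atBot (𝓝 l)) :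
    ∃ L, Tendsto f atBot (𝓝 L) := by
  have mono : ∀ {F F' : ℝ → ℝ}, (∀ t < t₁, HasDerivAt F (F' t) t) → (∀ t < t₁, 0 ≤ F' t) →
      MonotoneOn F (Iio t₁) := fun {F F'} hF hF' =>
    monotoneOn_of_deriv_nonneg (convex_Iio t₁)
      (fun t ht => (hF t ht).continuousAt.continuousWithinAt)
      (fun t ht => by
        rw [interior_Iio] at ht
        exact (hF t ht).differentiableAt.differentiableWithinAt)
      (fun t ht => by
        rw [interior_Iio] at ht
        rw [(hF t ht).deriv]; exact hF' t ht)
  have hu : MonotoneOn (fun t => f t + g t) (Iio t₁) :=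
    mono (fun t ht => (hf t ht).add (hg t ht)) fun t ht => by
      linarith [neg_abs_le (f' t), hle t ht]
  have hv : MonotoneOn (fun t => g t - f t) (Iio t₁) :=
    mono (fun t ht => (hg t ht).sub (hf t ht)) fun t ht => by
      linarith [le_abs_self (f' t), hle t ht]
  have hgm : MonotoneOn g (Iio t₁) := mono hg fun t ht => (abs_nonneg _).trans (hle t ht)
  have hlt : ∀ t, min t (t₁ - 1) < t₁ := fun t => (min_le_right _ _).trans_lt (by linarith)
  -- Freezing the argument at `t₁ - 1` yields a globally monotone function with the same behaviour
  -- at `-∞`.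
  have hu' : Monotone (fun t => f (min t (t₁ - 1)) + g (min t (t₁ - 1))) := fun s t hst =>
    hu (hlt s) (hlt t) (min_le_min_right _ hst)
  have hl : ∀ t < t₁, l ≤ g t := fun t ht => by
    refine le_of_tendsto hgl ?_
    filter_upwards [eventually_le_atBot t] with s hs
    exact hgm (hs.trans_lt ht) ht hs
  have hb : BddBelow (range (fun t => f (min t (t₁ - 1)) + g (min t (t₁ - 1)))) := by
    refine ⟨2 * l - (g (t₁ - 1) - f (t₁ - 1)), ?_⟩
    rintro _ ⟨t, rfl⟩
    have h1 := hv (hlt t) (show t₁ - 1 < t₁ by linarith) (min_le_right _ _)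
    have h2 := hl _ (hlt t)
    simp only at h1 ⊢
    linarith
  have h3 := (tendsto_atBot_ciInf hu' hb).sub hgl
  refine ⟨_, h3.congr' ?_⟩
  filter_upwards [eventually_le_atBot (t₁ - 1)] with t ht
  rw [min_eq_left ht]; ring

lemma exists_hasDerivAt_of_continuousOn_Iio {f : ℝ → ℝ} {T : ℝ} (hf : ContinuousOn f (Iio T)) :
    ∃ F : ℝ → ℝ, ∀ t < T, HasDerivAt F (f t) t := by
  refine ⟨fun t => ∫ u in (T - 1)..t, f u, fun t ht => ?_⟩
  refine intervalIntegral.integral_hasDerivAt_right ?_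
    (hf.stronglyMeasurableAtFilter isOpen_Iio t ht) (hf.continuousAt (Iio_mem_nhds ht))
  refine (hf.mono fun u hu => ?_).intervalIntegrable
  exact hu.2.trans_lt (max_lt (by linarith) ht)

/-- Inversion of `dF/dt = f > 0` with `F → 0` as `t → -∞`. -/
lemma exists_inverse_of_tendsto_atBot {F f : ℝ → ℝ} {t₁ : ℝ}
    (hF : ∀ t < t₁, HasDerivAt F (f t) t) (hf : ∀ t < t₁, 0 < f t)
    (hlim : Tendsto F atBot (𝓝 0)) :
    ∃ δ > 0, ∃ τ : ℝ → ℝ, (∀ s ∈ Ioo 0 δ, τ s < t₁ ∧ HasDerivAt τ (f (τ s))⁻¹ s) ∧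
      Tendsto τ (𝓝[>] 0) atBot := by
  have hmono : StrictMonoOn F (Iio t₁) :=
    strictMonoOn_of_deriv_pos (convex_Iio t₁)
      (fun t ht => (hF t ht).continuousAt.continuousWithinAt)
      (fun t ht => by
        rw [interior_Iio] at ht
        rw [(hF t ht).deriv]; exact hf t ht)
  have hpos : ∀ t < t₁, 0 < F t := fun t ht => by
    have h1 : F (t - 1) < F t := hmono (show t - 1 < t₁ by linarith) ht (by linarith)
    refine lt_of_le_of_lt (le_of_tendsto hlim ?_) h1
    filter_upwards [eventually_le_atBot (t - 1)] with s hs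
    exact hmono.monotoneOn (show s < t₁ by linarith) (show t - 1 < t₁ by linarith) hs
  -- Nothing is assumed about `F` at `t₁`; at the interior point `t₂` the value `F t₂` bounds the
  -- range on `Iio t₂`.
  let t₂ := t₁ - 1
  have ht₂ : t₂ < t₁ := by simp [t₂]
  have hsub : Iio t₂ ⊆ Iio t₁ := Iio_subset_Iio ht₂.le
  have himg : ∀ s ∈ Ioo 0 (F t₂), ∃ t ∈ Iio t₂, F t = s := fun s hs => by
    obtain ⟨t₀, h0, h0'⟩ := ((hlim.eventually (gt_mem_nhds hs.1)).and
      (eventually_lt_atBot t₂)).exists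
    obtain ⟨t, ht, rfl⟩ := intermediate_value_Ioo h0'.le
      (f := F) (fun t ht => (hF t (ht.2.trans_lt ht₂)).continuousAt.continuousWithinAt)
      ⟨h0, hs.2⟩
    exact ⟨t, ht.2, rfl⟩
  let τ := Function.invFunOn F (Iio t₂)
  have hτ : ∀ s ∈ Ioo 0 (F t₂), τ s < t₂ ∧ F (τ s) = s := fun s hs =>
    ⟨Function.invFunOn_mem (himg s hs), Function.invFunOn_eq (himg s hs)⟩
  have hτm : StrictMonoOn τ (Ioo 0 (F t₂)) := fun s hs u hu hsu => by
    refine (hmono.lt_iff_lt (hsub (hτ s hs).1) (hsub (hτ u hu).1)).1 ?_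
    rw [(hτ s hs).2, (hτ u hu).2]; exact hsu
  have hτimg : τ '' Ioo 0 (F t₂) = Iio t₂ := by
    ext t
    constructor
    · rintro ⟨s, hs, rfl⟩; exact (hτ s hs).1
    · intro ht
      have hs : F t ∈ Ioo 0 (F t₂) := ⟨hpos t (hsub ht), hmono (hsub ht) ht₂ ht⟩
      exact ⟨F t, hs, hmono.injOn (hsub (hτ _ hs).1) (hsub ht) (hτ _ hs).2⟩
  refine ⟨F t₂, hpos _ ht₂, τ, fun s hs => ⟨(hτ s hs).1.trans ht₂, ?_⟩, ?_⟩
  · have hc : ContinuousAt τ s := hτm.continuousAt_of_image_mem_nhds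
      (Ioo_mem_nhds hs.1 hs.2) (by rw [hτimg]; exact Iio_mem_nhds (hτ s hs).1)
    refine HasDerivAt.of_local_left_inverse hc (hF _ (hsub (hτ s hs).1))
      (hf _ (hsub (hτ s hs).1)).ne' ?_
    filter_upwards [Ioo_mem_nhds hs.1 hs.2] with u hu
    exact (hτ u hu).2
  · rw [tendsto_atBot]
    intro b
    have hb : min b (t₂ - 1) < t₂ := (min_le_right _ _).trans_lt (by linarith)
    have hFb : F (min b (t₂ - 1)) < F t₂ := hmono (hsub hb) ht₂ hb
    filter_upwards [Ioo_mem_nhdsGT (hpos _ (hsub hb))] with s hs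
    have hs' : s ∈ Ioo 0 (F t₂) := ⟨hs.1, hs.2.trans hFb⟩
    refine le_trans (le_of_lt ?_) (min_le_left b (t₂ - 1))
    refine (hmono.lt_iff_lt (hsub (hτ s hs').1) (hsub hb)).1 ?_
    rw [(hτ s hs').2]; exact hs.2

lemma ParallelAt.sum_const_mul {g : Metric} {γ : ℝ → Point} {v : Point} {s : ℝ}
    {E : ℝ → Fin 4 → Fin 4 → ℝ} (h : ∀ m, ParallelAt g γ v s (fun u => E u m)) (c : Fin 4 → ℝ) :
    ParallelAt g γ v s (fun u ρ => ∑ m, c m * E u m ρ) := by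
  intro ρ
  refine (HasDerivAt.fun_sum (u := Finset.univ) fun m _ => (h m ρ).const_mul (c m)).congr_deriv ?_
  simp only [mul_neg, Finset.sum_neg_distrib, Finset.mul_sum]
  congr 1
  rw [Finset.sum_comm]
  refine Finset.sum_congr rfl fun α _ => ?_
  rw [Finset.sum_comm]
  exact Finset.sum_congr rfl fun β _ => Finset.sum_congr rfl fun m _ => by ring

/-- A tetrad adapted to the null direction `∂_t + a⁻¹ ∂_x`, where `b` is the scale factor. -/
noncomputable def nullTetrad (b : ℝ) (m i : Fin 4) : ℝ :=
  (![![1 / 2, 0, 0, 0], ![1 / 2, 0, 0, 0], ![0, 0, 1, 0], ![0, 0, 0, 1]] : Matrix _ _ ℝ) m i * b⁻¹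
  + (![![1 / 2, 0, 0, 0], ![-1 / 2, 0, 0, 0], 0, 0] : Matrix (Fin 4) (Fin 4) ℝ) m i * b
  + (![![0, 1 / 2, 0, 0], ![0, 1 / 2, 0, 0], 0, 0] : Matrix (Fin 4) (Fin 4) ℝ) m i * b⁻¹ ^ 2
  + (![![0, -1 / 2, 0, 0], ![0, 1 / 2, 0, 0], 0, 0] : Matrix (Fin 4) (Fin 4) ℝ) m i

section

variable {a : ℝ → ℝ} {T T₁ : ℝ}

/-- The affine parameter is `s = ∫ a dt` from `-∞`, finite because `a ≤ K ȧ` dominates the integrand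
by the derivative of `K a`. The curve moves in the `x` direction with `dx/dt = 1/a`. -/
lemma exists_nullGeodesic (ha : ContDiffOn ℝ 2 a (Iio T)) (ha_pos : ∀ t < T, 0 < a t)
    (ha_lim : Tendsto a atBot (𝓝 0)) (hT : T₁ ≤ T) {K : ℝ}
    (hK : ∀ t < T₁, a t ≤ K * deriv a t) :
    ∃ δ γ k E, IsNullGeodesicFromPast a T δ γ k ∧ IsPPTetrad a δ γ k E ∧ ∀ s ∈ Ioo 0 δ,
      γ s 0 < T₁ ∧ (∀ μ, k s μ = E s 0 μ + E s 1 μ) ∧ k s 0 = (a (γ s 0))⁻¹ ∧ E s 2 0 = 0 := by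
  have hac : ContinuousOn a (Iio T) := ha.continuousOn
  obtain ⟨F, hF⟩ := exists_hasDerivAt_of_continuousOn_Iio hac
  obtain ⟨X, hX⟩ := exists_hasDerivAt_of_continuousOn_Iio
    (f := fun t => (a t)⁻¹) (T := T) (hac.inv₀ fun t ht => (ha_pos t ht).ne')
  obtain ⟨L, hL⟩ := exists_tendsto_atBot_of_abs_deriv_le (t₁ := T₁) (f := F) (f' := a)
    (g := fun t => K * a t) (g' := fun t => K * deriv a t) (l := K * 0)
    (fun t ht => hF t (ht.trans_le hT))
    (fun t ht => (hasDerivAt_scale ha (ht.trans_le hT)).const_mul K)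
    (fun t ht => by rw [abs_of_pos (ha_pos t (ht.trans_le hT))]; exact hK t ht)
    (ha_lim.const_mul K)
  obtain ⟨δ, hδ, τ, hτ, hτlim⟩ := exists_inverse_of_tendsto_atBot (t₁ := T₁)
    (F := fun t => F t - L) (f := a) (fun t ht => (hF t (ht.trans_le hT)).sub_const L)
    (fun t ht => ha_pos t (ht.trans_le hT)) (by simpa using hL.sub_const L)
  let γ : ℝ → Point := fun s => ![τ s, X (τ s), 0, 0]
  let E : ℝ → Fin 4 → Fin 4 → ℝ := fun s => nullTetrad (a (τ s))
  -- The tangent is `E₀ + E₁`, so the geodesic equation follows from parallelism of the tetrad.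
  let k : ℝ → Point := fun s μ => ∑ m, (![1, 1, 0, 0] : Fin 4 → ℝ) m * E s m μ
  have hk : ∀ s, k s = ![(a (τ s))⁻¹, (a (τ s))⁻¹ ^ 2, 0, 0] := fun s => by
    ext i
    simp only [k, E, Fin.sum_univ_four, nullTetrad]
    fin_cases i <;> simp <;> ring
  have hb : ∀ s ∈ Ioo 0 δ, HasDerivAt (fun u => a (τ u)) (deriv a (τ s) * (a (τ s))⁻¹) s :=
    fun s hs => (hasDerivAt_scale ha ((hτ s hs).1.trans_le hT)).comp s (hτ s hs).2
  have hpar : ∀ s ∈ Ioo 0 δ, ∀ m, ParallelAt (flrwMetric a) γ (k s) s (fun u => E u m) := by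
    intro s hs m
    have h0 := (ha_pos _ ((hτ s hs).1.trans_le hT)).ne'
    have hd : ∀ i, HasDerivAt (fun u => E u m i) _ s := fun i =>
      ((((hb s hs).inv h0).const_mul _).add ((hb s hs).const_mul _) |>.add
        ((((hb s hs).inv h0).pow 2).const_mul _)).add_const _
    rw [parallelAt_flrwMetric ha ha_pos ((hτ s hs).1.trans_le hT)]
    refine ⟨(hd 0).congr_deriv ?_, fun i hi => (hd i).congr_deriv ?_⟩
    · rw [hk]
      simp only [E, γ, nullTetrad]
      fin_cases m <;> simp <;> field_simp <;> ring
    · rw [hk]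
      simp only [E, γ, nullTetrad]
      fin_cases m <;> fin_cases i <;> simp at hi ⊢ <;> field_simp <;> ring
  refine ⟨δ, γ, k, E, ⟨hδ, fun s hs => (hτ s hs).1.trans_le hT, fun s hs => ?_,
    fun s hs => ParallelAt.sum_const_mul (hpar s hs) _, fun s hs h => ?_, fun s hs => ?_, hτlim⟩,
    ⟨fun s hs m n => ?_, fun s hs m => hpar s hs m⟩, fun s hs => ⟨(hτ s hs).1, fun μ => ?_, ?_, ?_⟩⟩
  · rw [hk, hasDerivAt_pi]
    intro i
    fin_cases i
    · exact (hτ s hs).2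
    · refine ((hX _ ((hτ s hs).1.trans_le hT)).comp s (hτ s hs).2).congr_deriv ?_
      simp; ring
    · exact hasDerivAt_const _ _
    · exact hasDerivAt_const _ _
  · have h0 := (ha_pos _ ((hτ s hs).1.trans_le hT)).ne'
    have := congrFun h 0
    rw [hk] at this
    simp [h0] at this
  · have h0 := (ha_pos _ ((hτ s hs).1.trans_le hT)).ne'
    change ip a (γ s) (k s) (k s) = 0
    rw [ip_eq, hk]
    simp [γ]
    field_simp
    ring
  · have h0 := (ha_pos _ ((hτ s hs).1.trans_le hT)).ne'
    change ip a (γ s) (E s m) (E s n) = _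
    rw [ip_eq]
    simp only [E, γ, nullTetrad]
    fin_cases m <;> fin_cases n <;> simp <;> field_simp <;> ring
  · simp [k, Fin.sum_univ_four]
  · rw [hk]; rfl
  · simp [E, nullTetrad]

end

/-! ### Divergence of high derivatives for an exponent that is not a natural number. -/

lemma ev_sum_const_mul {n : ℕ} (S : CovTensor n) (x : Point) (c : Fin n → Fin 4 → ℝ)
    (e : Fin 4 → Fin 4 → ℝ) :
    ev S x (fun j ρ => ∑ m, c j m * e m ρ)
      = ∑ m : Fin n → Fin 4, (∏ j, c j (m j)) * ev S x (fun j => e (m j)) := by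
  unfold ev
  simp only [Finset.prod_univ_sum, Fintype.piFinset_univ, Finset.mul_sum]
  rw [Finset.sum_comm]
  refine Finset.sum_congr rfl fun m _ => Finset.sum_congr rfl fun μ _ => ?_
  rw [Finset.prod_mul_distrib]
  ring

/-- Coefficients, in the tetrad, of the arguments of `(∇_k)^r R(k, E₂, k, E₂)`. -/
def nullCoeff : (r : ℕ) → Fin (4 + r) → Fin 4 → ℝ
  | 0 => ![![1, 1, 0, 0], ![0, 0, 1, 0], ![1, 1, 0, 0], ![0, 0, 1, 0]]
  | r + 1 => Fin.cons (α := fun _ => Fin 4 → ℝ) ![1, 1, 0, 0] (nullCoeff r)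

lemma contDiffOn_sqrt_affine {A B : ℝ} :
    ContDiffOn ℝ ∞ (fun x => √(A + B * x)) {x | 0 < A + B * x} := 
  (ContDiff.contDiffOn (by fun_prop)).sqrt fun _ hx => ne_of_gt hx

lemma isOpen_affine_pos {A B : ℝ} : IsOpen {x : ℝ | 0 < A + B * x} :=
  isOpen_lt continuous_const (by fun_prop)

/-- Iterated derivatives of `b ^ p` along `b' = √(A + B b ^ m)`. -/
lemma exists_iterated_deriv_rpow {A B m p C δ : ℝ} {b : ℝ → ℝ} {f : ℕ → ℝ → ℝ} (hA : 0 < A)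
    (hC : C ≠ 0) (hp : ∀ j : ℕ, p ≠ j) (hb : ∀ s ∈ Ioo 0 δ, 0 < b s)
    (hAB : ∀ s ∈ Ioo 0 δ, 0 < A + B * b s ^ m)
    (hb' : ∀ s ∈ Ioo 0 δ, HasDerivAt b √(A + B * b s ^ m) s)
    (hf0 : ∀ s ∈ Ioo 0 δ, f 0 s = C * b s ^ p)
    (hf : ∀ r, ∀ s ∈ Ioo 0 δ, HasDerivAt (f r) (f (r + 1) s) s) (r : ℕ) :
    ∃ Q : ℝ → ℝ, ContDiffOn ℝ ∞ Q {x | 0 < A + B * x} ∧ Q 0 ≠ 0 ∧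
      ∀ s ∈ Ioo 0 δ, f r s = b s ^ (p - r) * Q (b s ^ m) := by
  induction r with
  | zero =>
    refine ⟨fun _ => C, contDiffOn_const, hC, fun s hs => ?_⟩
    rw [hf0 s hs]; simp [mul_comm]
  | succ r ih =>
    obtain ⟨Q, hQ, hQ0, hfQ⟩ := ih
    -- Product rule for `b^(p-r) Q(b^m)` with `x = b^m`, after extracting `b^(p-r-1)` and the factor
    -- `b' = √(A + B x)`. At `x = 0` the result is `√A (p-r) Q 0`, nonzero because `p ≠ r`.
    refine ⟨fun x => √(A + B * x) * ((p - r) * Q x + m * (x * deriv Q x)), ?_, ?_, ?_⟩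
    · exact contDiffOn_sqrt_affine.mul ((contDiffOn_const.mul hQ).add (contDiffOn_const.mul
        (contDiffOn_id.mul (hQ.deriv_of_isOpen isOpen_affine_pos (by simp)))))
    · have h1 : √A ≠ 0 := (Real.sqrt_pos.2 hA).ne'
      have h2 : p - r ≠ 0 := sub_ne_zero.2 (hp r)
      simp [h1, h2, hQ0]
    · intro s hs
      have hbs := hb s hs
      have hQd : HasDerivAt Q (deriv Q (b s ^ m)) (b s ^ m) :=
        ((hQ.contDiffAt (isOpen_affine_pos.mem_nhds (hAB s hs))).differentiableAt
          (by simp)).hasDerivAt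
      have h1 := ((hb' s hs).rpow_const (p := p - r) (Or.inl hbs.ne')).mul
        (hQd.comp s ((hb' s hs).rpow_const (p := m) (Or.inl hbs.ne')))
      have h2 : f r =ᶠ[𝓝 s] fun u => b u ^ (p - r) * Q (b u ^ m) := by
        filter_upwards [Ioo_mem_nhds hs.1 hs.2] with u hu
        exact hfQ u hu
      rw [(hf r s hs).unique (h1.congr_of_eventuallyEq h2)]
      have e1 : b s ^ (p - r) = b s ^ (p - (r + 1 : ℕ)) * b s := by
        rw [← Real.rpow_add_one hbs.ne']; congr 1; push_cast; ring
      have e2 : b s ^ m = b s ^ (m - 1) * b s := by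
        rw [← Real.rpow_add_one hbs.ne']; congr 1; ring
      have e3 : p - r - 1 = p - (r + 1 : ℕ) := by push_cast; ring
      simp only [Function.comp, e3]
      rw [e1]
      linear_combination (-(√(A + B * b s ^ m) * m * deriv Q (b s ^ m)
        * b s ^ (p - (r + 1 : ℕ)))) * e2

section

variable {a : ℝ → ℝ} {T T₁ A B m C p K : ℝ}

lemma contDiffOn_rpow {q : ℝ} {U : Set ℝ} (hU : ∀ x ∈ U, 0 < x) :
    ContDiffOn ℝ ∞ (fun x : ℝ => x ^ q) U := fun x hx =>
  (contDiffAt_id.rpow_const_of_ne (hU x hx).ne').contDiffWithinAt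

/-- The functions `f r = (∇_k)^r R(k, E₂, k, E₂)` are successive derivatives in `s`, because `k` and
`E₂` are parallel. Convergence of all tetrad components would make `f r` converge, but it grows like
`a^(p-r)`. -/
lemma isPPCurvatureSingularity_of_rpow (ha : ContDiffOn ℝ 2 a (Iio T))
    (ha_pos : ∀ t < T, 0 < a t) (ha_lim : Tendsto a atBot (𝓝 0)) (hT : T₁ ≤ T)
    (hK : ∀ t < T₁, a t ≤ K * deriv a t) (hA : 0 < A) (hm : 0 < m) (hC : C ≠ 0)
    (hp : ∀ j : ℕ, p ≠ j) (hAB : ∀ t < T₁, 0 < A + B * a t ^ m)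
    (hda : ∀ t < T₁, deriv a t = a t * √(A + B * a t ^ m))
    (hH : ∀ t < T₁, deriv (hubble a) t / a t ^ 2 = C * a t ^ p) {r : ℕ} (hr : p < r) :
    IsPPCurvatureSingularity a T r := by
  obtain ⟨δ, γ, k, E, hγ, hE, hs⟩ := exists_nullGeodesic ha ha_pos ha_lim hT hK
  refine ⟨δ, γ, k, E, hγ, hE, ?_⟩
  by_contra! hcon
  -- The point `0` is excluded: a real power need not be smooth there, and only differentiability of
  -- the tensor before the boundary is needed.
  let U : Set ℝ := {x | 0 < x ∧ 0 < A + B * x ^ m}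
  have hUpos : ∀ x ∈ U, 0 < x := fun x hx => hx.1
  have hmc : ContinuousOn (fun x : ℝ => A + B * x ^ m) (Ioi 0) :=
    continuousOn_const.add (continuousOn_const.mul
      (continuousOn_id.rpow_const fun x _ => Or.inr hm.le))
  have hU : IsOpen U := hmc.isOpen_inter_preimage isOpen_Ioi isOpen_Ioi
  have hh : ContDiffOn ℝ ∞ (fun x => √(A + B * x ^ m)) U :=
    (contDiffOn_const.add (contDiffOn_const.mul (contDiffOn_rpow hUpos))).sqrt
      fun x hx => hx.2.ne'
  have hST := isScaleTensor_iterCovDerivRiemann ha ha_pos hT hU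
    (fun t ht => ⟨ha_pos t (ht.trans_le hT), hAB t ht⟩) hh
    (contDiffOn_const.mul (contDiffOn_rpow hUpos)) hda hH
  let V : (r : ℕ) → ℝ → Fin (4 + r) → Fin 4 → ℝ :=
    fun r s j ρ => ∑ n, nullCoeff r j n * E s n ρ
  let f : ℕ → ℝ → ℝ := fun r s => ev (iterCovDerivRiemann (flrwMetric a) r) (γ s) (V r s)
  have hk : ∀ s ∈ Ioo 0 δ, k s = fun ρ => ∑ n, (![1, 1, 0, 0] : Fin 4 → ℝ) n * E s n ρ :=
    fun s h => by
      ext ρ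
      rw [(hs s h).2.1]
      simp [Fin.sum_univ_four]
  have hf : ∀ r, ∀ s ∈ Ioo 0 δ, HasDerivAt (f r) (f (r + 1) s) s := fun r s h => by
    refine (hasDerivAt_ev (fun μ => (hST r).differentiableAt ha hT hU
      (fun t ht => ⟨ha_pos t (ht.trans_le hT), hAB t ht⟩) (hs s h).1 μ) (hγ.tangent s h)
      (fun j => ParallelAt.sum_const_mul (hE.parallelAt h) (nullCoeff r j))).congr_deriv ?_
    change ev _ _ _ = ev _ _ _
    congr 1
    funext j
    refine Fin.cases ?_ (fun i => ?_) j
    · exact hk s h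
    · rfl
  let b : ℝ → ℝ := fun s => a (γ s 0)
  have hb : ∀ s ∈ Ioo 0 δ, 0 < b s := fun s h => ha_pos _ (hγ.mem s h)
  have hb' : ∀ s ∈ Ioo 0 δ, HasDerivAt b √(A + B * b s ^ m) s := fun s h => by
    refine (hasDerivAt_scale_comp ha (hγ.mem s h) (hγ.tangent s h)).congr_deriv ?_
    have := (hb s h).ne'
    rw [hda _ (hs s h).1, (hs s h).2.2.1]
    simp only [b] at this ⊢
    field_simp
  -- The `H²` term vanishes since `k` is null and orthogonal to `E₂`. With `ℓ(k) = -1` and `ℓ(E₂) =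
  -- 0`, only `-Ḣ/a²` survives.
  have hf0 : ∀ s ∈ Ioo 0 δ, f 0 s = -C * b s ^ p := fun s h => by
    have hip := hE.ip_eq_mink h
    have h0 := (hb s h).ne'
    have e0 : V 0 s 0 = k s := (hk s h).symm
    have e2 : V 0 s 2 = k s := (hk s h).symm
    have e1 : V 0 s 1 = E s 2 := by
      ext ρ
      change ∑ n, (![0, 0, 1, 0] : Fin 4 → ℝ) n * E s n ρ = _
      simp [Fin.sum_univ_four]
    have e3 : V 0 s 3 = E s 2 := e1
    have hkE : ∀ n, ip a (γ s) (k s) (E s n) = mink 0 n + mink 1 n := fun n => by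
      rw [← hip 0 n, ← hip 1 n]
      simp only [ip_eq, (hs s h).2.1]
      ring
    have hkk : ip a (γ s) (k s) (k s) = 0 := hγ.null s h
    have hl : ell a (γ s) (k s) = -1 := by
      simp only [b] at h0
      rw [ell, (hs s h).2.2.1]; field_simp
    have hl2 : ell a (γ s) (E s 2) = 0 := by rw [ell, (hs s h).2.2.2, mul_zero]
    have := ev_riemann ha ha_pos (hγ.mem s h) (V 0 s)
    rw [e0, e1, e2, e3, hkk, hl, hl2, hip, ip_comm (γ s) (E s 2) (k s), hkE,
      hH _ (hs s h).1] at this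
    refine this.trans ?_
    simp [mink, b]
  obtain ⟨Q, hQ, hQ0, hfQ⟩ := exists_iterated_deriv_rpow hA (neg_ne_zero.2 hC) hp hb
    (fun s h => hAB _ (hs s h).1) hb' hf0 hf r
  have hb0 : Tendsto b (𝓝[>] 0) (𝓝[>] 0) := by
    refine tendsto_nhdsWithin_iff.2 ⟨ha_lim.comp hγ.toBoundary, ?_⟩
    filter_upwards [Ioo_mem_nhdsGT_zero hγ.pos] with s h
    exact hb s h
  have hbm : Tendsto (fun s => b s ^ m) (𝓝[>] 0) (𝓝 0) := by
    have := (hb0.mono_right nhdsWithin_le_nhds).rpow_const (p := m) (Or.inr hm.le)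
    rwa [Real.zero_rpow hm.ne'] at this
  have hQc : Tendsto (fun s => |Q (b s ^ m)|) (𝓝[>] 0) (𝓝 |Q 0|) :=
    ((hQ.contDiffAt (isOpen_affine_pos.mem_nhds
      (show 0 < A + B * 0 by simpa using hA))).continuousAt.tendsto.comp hbm).abs
  have hdiv : Tendsto (fun s => |f r s|) (𝓝[>] 0) atTop := by
    have h1 : Tendsto (fun s => b s ^ (p - r)) (𝓝[>] 0) atTop :=
      (tendsto_rpow_neg_nhdsGT_zero (sub_neg.2 hr)).comp hb0
    refine (h1.atTop_mul_pos (abs_pos.2 hQ0) hQc).congr' ?_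
    filter_upwards [Ioo_mem_nhdsGT_zero hγ.pos] with s h
    rw [hfQ s h, abs_mul, abs_of_pos (Real.rpow_pos_of_pos (hb s h) _)]
  choose L hL using hcon
  -- The coefficients of `k` and `E₂` in the tetrad are constant, so `f r` is a fixed linear
  -- combination of components.
  have hconv : Tendsto (f r) (𝓝[>] 0) (𝓝 (∑ n, (∏ j, nullCoeff r j (n j)) * L n)) := by
    refine (tendsto_finsetSum Finset.univ fun n _ =>
      (hL n).const_mul (∏ j, nullCoeff r j (n j))).congr fun s => ?_
    exact (ev_sum_const_mul _ _ _ _).symm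
  exact not_tendsto_nhds_of_tendsto_atTop hdiv _ hconv.abs

end

/-! ### Evolution of the scale factor and of the Hubble parameter. -/

section

variable {a ρ : ℝ → ℝ} {T M Λ w A B m : ℝ}

lemma deriv_scale_eq (ha_pos : ∀ t < T, 0 < a t) {t : ℝ} (ht : t < T) :
    deriv a t = a t * hubble a t := by
  have := (ha_pos t ht).ne'
  rw [hubble]; field_simp

lemma hasDerivAt_scale_rpow (ha : ContDiffOn ℝ 2 a (Iio T)) (ha_pos : ∀ t < T, 0 < a t) (q : ℝ)
    {t : ℝ} (ht : t < T) :
    HasDerivAt (fun t => a t ^ q) (q * hubble a t * a t ^ q) t := by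
  have h0 := ha_pos t ht
  refine ((hasDerivAt_scale ha ht).rpow_const (Or.inl h0.ne')).congr_deriv ?_
  have e : a t ^ q = a t ^ (q - 1) * a t := by
    rw [← Real.rpow_add_one h0.ne']; congr 1; ring
  rw [deriv_scale_eq ha_pos ht, e]; ring

/-- Conservation of energy. -/
lemma exists_density_eq (ha : ContDiffOn ℝ 2 a (Iio T)) (ha_pos : ∀ t < T, 0 < a t) (hM : 0 < M)
    (hE : SolvesEinstein M Λ w T a ρ) (hρ : ∃ t < T, ρ t ≠ 0) :
    ∃ C, C ≠ 0 ∧ ∀ t < T, ρ t = C * a t ^ (-3 * (1 + w)) := by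
  have hF := fun t (ht : t < T) => friedmann ha ha_pos hM hE ht
  obtain ⟨C, hC⟩ := exists_eq_const_of_hasDerivAt_zero
    (f := fun t => (3 * M ^ 2 * hubble a t ^ 2 - Λ) * a t ^ (3 * (1 + w)))
    isOpen_Iio (isPreconnected_Iio (a := T)) (fun t ht => by
      refine (((((hF t ht).2.pow 2).const_mul (3 * M ^ 2)).sub_const Λ).mul
        (hasDerivAt_scale_rpow ha ha_pos (3 * (1 + w)) ht)).congr_deriv ?_
      rw [(hF t ht).1]
      simp only [Pi.pow_apply]
      field_simp
      ring)
  have hρC : ∀ t < T, ρ t = C * a t ^ (-3 * (1 + w)) := fun t ht => by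
    rw [← hC t ht, ← (hF t ht).1, mul_assoc, ← Real.rpow_add (ha_pos t ht)]
    simp
  refine ⟨C, ?_, hρC⟩
  rintro rfl
  obtain ⟨t, ht, h⟩ := hρ
  exact h (by rw [hρC t ht, zero_mul])

lemma deriv_hubble_div (ha : ContDiffOn ℝ 2 a (Iio T)) (ha_pos : ∀ t < T, 0 < a t) (hM : 0 < M)
    (hE : SolvesEinstein M Λ w T a ρ) {C : ℝ} (hρC : ∀ t < T, ρ t = C * a t ^ (-3 * (1 + w)))
    {t : ℝ} (ht : t < T) :
    deriv (hubble a) t / a t ^ 2 = -(C * (1 + w) / (2 * M ^ 2)) * a t ^ (-5 - 3 * w) := by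
  have h0 := ha_pos t ht
  have e : a t ^ (-3 * (1 + w)) = a t ^ (-5 - 3 * w) * a t ^ 2 := by
    rw [← Real.rpow_natCast, ← Real.rpow_add h0]; congr 1; push_cast; ring
  rw [(friedmann ha ha_pos hM hE ht).2.deriv, hρC t ht, e]
  field_simp

lemma hubble_sq (ha : ContDiffOn ℝ 2 a (Iio T)) (ha_pos : ∀ t < T, 0 < a t) (hM : 0 < M)
    (hE : SolvesEinstein M Λ w T a ρ) {C : ℝ} (hρC : ∀ t < T, ρ t = C * a t ^ (-3 * (1 + w)))
    {t : ℝ} (ht : t < T) :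
    hubble a t ^ 2 = Λ / (3 * M ^ 2) + C / (3 * M ^ 2) * a t ^ (-3 * (1 + w)) := by
  have h := (friedmann ha ha_pos hM hE ht).1
  rw [hρC t ht] at h
  generalize a t ^ (-3 * (1 + w)) = y at *
  field_simp
  linarith

/-- Since `a` tends to `0` but is positive at `t`, it has increased somewhere earlier; apply the
mean value theorem. -/
lemma exists_hubble_pos (ha : ContDiffOn ℝ 2 a (Iio T)) (ha_pos : ∀ t < T, 0 < a t)
    (ha_lim : Tendsto a atBot (𝓝 0)) {t : ℝ} (ht : t < T) :
    ∃ c < t, 0 < hubble a c := by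
  obtain ⟨s, hs, hst⟩ := ((ha_lim.eventually (gt_mem_nhds (ha_pos t ht))).and
    (eventually_lt_atBot t)).exists
  obtain ⟨c, hc, hc'⟩ := exists_deriv_eq_slope a hst
    (ha.continuousOn.mono fun u hu => hu.2.trans_lt ht) fun u hu =>
      (hasDerivAt_scale ha (hu.2.trans ht)).differentiableAt.differentiableWithinAt
  refine ⟨c, hc.2, div_pos ?_ (ha_pos c (hc.2.trans ht))⟩
  rw [hc']
  exact div_pos (by linarith) (by linarith)

lemma hubble_pos_of_ne_zero (ha : ContDiffOn ℝ 2 a (Iio T)) (ha_pos : ∀ t < T, 0 < a t)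
    (ha_lim : Tendsto a atBot (𝓝 0)) {T₁ : ℝ} (hT : T₁ ≤ T) (h : ∀ t < T₁, hubble a t ≠ 0)
    {t : ℝ} (ht : t < T₁) : 0 < hubble a t := by
  by_contra! hneg
  obtain ⟨c, hct, hc⟩ := exists_hubble_pos ha ha_pos ha_lim (ht.trans_le hT)
  obtain ⟨z, hz, hz0⟩ := intermediate_value_Icc' hct.le (f := hubble a)
    (fun u hu => (hasDerivAt_hubble ha ha_pos
      ((hu.2.trans_lt ht).trans_le hT)).continuousAt.continuousWithinAt) ⟨hneg, hc.le⟩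
  exact h z (hz.2.trans_lt ht) hz0

lemma tendsto_scale_rpow (ha_lim : Tendsto a atBot (𝓝 0)) {q : ℝ} (hq : 0 ≤ q) :
    Tendsto (fun t => a t ^ q) atBot (𝓝 (0 ^ q)) := ha_lim.rpow_const (Or.inr hq)

/-- Early on `H²` is near `A > 0`, so `H` has no zero and a constant sign; this sign is positive
because `a` grows from `0`. -/
lemma exists_early_hubble_eq_sqrt (ha : ContDiffOn ℝ 2 a (Iio T)) (ha_pos : ∀ t < T, 0 < a t)
    (ha_lim : Tendsto a atBot (𝓝 0)) (hA : 0 < A) (hm : 0 < m)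
    (hH : ∀ t < T, hubble a t ^ 2 = A + B * a t ^ m) :
    ∃ T₁ ≤ T, ∀ t < T₁, 0 < A + B * a t ^ m ∧ hubble a t = √(A + B * a t ^ m) ∧
      √A / 2 ≤ hubble a t := by
  have h1 : Tendsto (fun t => A + B * a t ^ m) atBot (𝓝 A) := by
    have := ((tendsto_scale_rpow ha_lim hm.le).const_mul B).const_add A
    simpa [Real.zero_rpow hm.ne'] using this
  -- The threshold `A / 4` is the square of `√A / 2`.
  obtain ⟨T₀, hT₀⟩ := eventually_atBot.1 (h1.eventually (lt_mem_nhds (show A / 4 < A by linarith)))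
  have hT₁ : ∀ t < min T₀ T, A / 4 < A + B * a t ^ m := fun t ht =>
    hT₀ t (ht.le.trans (min_le_left _ _))
  refine ⟨min T₀ T, min_le_right _ _, fun t ht => ?_⟩
  have hpos : 0 < hubble a t := by
    refine hubble_pos_of_ne_zero ha ha_pos ha_lim (min_le_right _ _) (fun u hu h0 => ?_) ht
    have := hH u (hu.trans_le (min_le_right _ _))
    rw [h0] at this
    linarith [hT₁ u hu]
  have heq : hubble a t = √(A + B * a t ^ m) := by
    rw [← hH t (ht.trans_le (min_le_right _ _)), Real.sqrt_sq hpos.le]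
  refine ⟨by linarith [hT₁ t ht], heq, ?_⟩
  rw [heq]
  refine Real.le_sqrt_of_sq_le ?_
  rw [div_pow, Real.sq_sqrt hA.le]
  linarith [hT₁ t ht]

/-- If `H` approaches a positive constant at the rate of a power of `a`, then the spacetime is
asymptotically de Sitter. -/
lemma exists_isEquivalent_exp (ha : ContDiffOn ℝ 2 a (Iio T)) (ha_pos : ∀ t < T, 0 < a t)
    (ha_lim : Tendsto a atBot (𝓝 0)) {T₁ HΛ K : ℝ} (hT : T₁ ≤ T) (hΛ : 0 < HΛ) (hm : 0 < m)
    (hK : 0 ≤ K) (hH : ∀ t < T₁, HΛ / 2 ≤ hubble a t ∧ |hubble a t - HΛ| ≤ K * a t ^ m) :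
    ∃ abar > 0, a ~[atBot] fun t => abar * Real.exp (HΛ * t) := by
  -- The derivative of `log a - HΛ t` is `H - HΛ`, bounded by `K a^m`. As `H ≥ HΛ/2`, the derivative
  -- `m H a^m` of `a^m` dominates it after multiplication by `2K/(HΛ m)`.
  obtain ⟨L, hL⟩ := exists_tendsto_atBot_of_abs_deriv_le (t₁ := T₁)
    (f := fun t => Real.log (a t) - HΛ * t) (f' := fun t => hubble a t - HΛ)
    (g := fun t => 2 * K / (HΛ * m) * a t ^ m)
    (g' := fun t => 2 * K / (HΛ * m) * (m * hubble a t * a t ^ m))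
    (fun t ht => by
      refine (((hasDerivAt_scale ha (ht.trans_le hT)).log
        (ha_pos t (ht.trans_le hT)).ne').sub ((hasDerivAt_id t).const_mul HΛ)).congr_deriv ?_
      rw [hubble, mul_one])
    (fun t ht => (hasDerivAt_scale_rpow ha ha_pos m (ht.trans_le hT)).const_mul _)
    (fun t ht => by
      refine (hH t ht).2.trans ?_
      have h1 : 2 * K / (HΛ * m) * (m * hubble a t * a t ^ m)
          = K * a t ^ m * (hubble a t / (HΛ / 2)) := by field_simp
      rw [h1]
      refine le_mul_of_one_le_right (mul_nonneg hK (Real.rpow_nonneg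
        (ha_pos t (ht.trans_le hT)).le _)) ?_
      rw [one_le_div (half_pos hΛ)]
      exact (hH t ht).1)
    ((tendsto_scale_rpow ha_lim hm.le).const_mul _)
  refine ⟨Real.exp L, Real.exp_pos L, ?_⟩
  rw [isEquivalent_iff_tendsto_one (Eventually.of_forall fun t =>
    (mul_pos (Real.exp_pos L) (Real.exp_pos _)).ne')]
  have h1 : Tendsto (fun t => Real.exp (Real.log (a t) - HΛ * t - L)) atBot (𝓝 1) := by
    have := (Real.continuous_exp.tendsto _).comp (hL.sub_const L)
    rwa [sub_self, Real.exp_zero] at this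
  refine h1.congr' ?_
  filter_upwards [eventually_lt_atBot T] with t ht
  rw [Real.exp_sub, Real.exp_sub, Real.exp_log (ha_pos t ht), Pi.div_apply, div_div, mul_comm
    (Real.exp (HΛ * t))]

lemma le_mul_deriv_scale (ha_pos : ∀ t < T, 0 < a t) {T₁ HΛ : ℝ} (hT : T₁ ≤ T) (hΛ : 0 < HΛ)
    (hH : ∀ t < T₁, HΛ / 2 ≤ hubble a t) : ∀ t < T₁, a t ≤ 2 / HΛ * deriv a t := fun t ht => by
  rw [deriv_scale_eq ha_pos (ht.trans_le hT)]
  have h1 : 2 / HΛ * (a t * hubble a t) = a t * (hubble a t / (HΛ / 2)) := by field_simp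
  rw [h1]
  refine le_mul_of_one_le_right (ha_pos t (ht.trans_le hT)).le ?_
  rw [one_le_div (half_pos hΛ)]
  exact hH t ht

/-- With natural exponents the functions giving `H` and `Ḣ/a²` are smooth near `a = 0`. The open set
of admissible scale factors now contains `0`, and continuity there gives the limits. -/
lemma isSmoothlyExtendible_of_pow (ha : ContDiffOn ℝ 2 a (Iio T)) (ha_pos : ∀ t < T, 0 < a t)
    (ha_lim : Tendsto a atBot (𝓝 0)) {T₁ C : ℝ} (hT : T₁ ≤ T) (hA : 0 < A) {n : ℕ}
    (hAB : ∀ t < T₁, 0 < A + B * a t ^ (n + 2))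
    (hda : ∀ t < T₁, deriv a t = a t * √(A + B * a t ^ (n + 2)))
    (hH : ∀ t < T₁, deriv (hubble a) t / a t ^ 2 = C * a t ^ n) :
    IsSmoothlyExtendible a T := by
  rintro r ⟨δ, γ, k, E, hγ, hE, i, hi⟩
  have hU : IsOpen {x : ℝ | 0 < A + B * x ^ (n + 2)} := isOpen_lt continuous_const (by fun_prop)
  have hST := isScaleTensor_iterCovDerivRiemann ha ha_pos hT hU hAB
    (h := fun x => √(A + B * x ^ (n + 2))) (G := fun x => C * x ^ n)
    ((ContDiff.contDiffOn (by fun_prop)).sqrt fun x hx => ne_of_gt hx)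
    (ContDiff.contDiffOn (by fun_prop)) hda hH r
  exact hi (hST.exists_tendsto hU (by simpa using hA) hγ hE ha ha_pos ha_lim i)

end

section

/-! ### Limit of the Hubble parameter. -/

variable {a ρ : ℝ → ℝ} {T M Λ w : ℝ}

/-- The case `w = -1`: the Hubble parameter is constant. -/
lemma exists_hubble_eq_const (ha : ContDiffOn ℝ 2 a (Iio T)) (ha_pos : ∀ t < T, 0 < a t)
    (ha_lim : Tendsto a atBot (𝓝 0)) (hH : ∀ t < T, HasDerivAt (hubble a) 0 t) :
    ∃ H₀ > 0, ∀ t < T, hubble a t = H₀ := by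
  obtain ⟨H₀, h⟩ := exists_eq_const_of_hasDerivAt_zero isOpen_Iio (isPreconnected_Iio (a := T)) hH
  obtain ⟨c, hc, hpos⟩ := exists_hubble_pos ha ha_pos ha_lim (show T - 1 < T by linarith)
  exact ⟨H₀, h c (show c < T by linarith) ▸ hpos, h⟩

lemma abs_sqrt_sub_sqrt_le {A x : ℝ} (hA : 0 < A) (hx : 0 ≤ A + x) :
    |√(A + x) - √A| ≤ |x| / √A := by
  have h1 := Real.sqrt_pos.2 hA
  have h2 := Real.sqrt_nonneg (A + x)
  have h3 : x = (√(A + x) - √A) * (√(A + x) + √A) := by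
    have e1 := Real.sq_sqrt hA.le
    have e2 := Real.sq_sqrt hx
    linear_combination e1 - e2
  rw [le_div_iff₀ h1]
  conv_rhs => rw [h3, abs_mul, abs_of_nonneg (add_nonneg h2 h1.le)]
  exact mul_le_mul_of_nonneg_left (by linarith) (abs_nonneg _)

/-- The rate at which the Hubble parameter approaches its limit. -/
lemma exists_hubble_asymptotics (ha : ContDiffOn ℝ 2 a (Iio T)) (ha_pos : ∀ t < T, 0 < a t)
    (ha_lim : Tendsto a atBot (𝓝 0)) (hM : 0 < M) (hΛ : 0 < Λ) (hw : w ≤ -1)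
    (hE : SolvesEinstein M Λ w T a ρ) {C : ℝ} (hρC : ∀ t < T, ρ t = C * a t ^ (-3 * (1 + w))) :
    ∃ T₁ HΛ m K : ℝ, T₁ ≤ T ∧ 0 < HΛ ∧ 0 < m ∧ 0 ≤ K ∧
      (w < -1 → HΛ = √(Λ / (3 * M ^ 2))) ∧
      ∀ t < T₁, HΛ / 2 ≤ hubble a t ∧ |hubble a t - HΛ| ≤ K * a t ^ m := by
  have hA : 0 < Λ / (3 * M ^ 2) := by positivity
  rcases hw.lt_or_eq with hw | rfl
  · have hm : 0 < -3 * (1 + w) := by linarith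
    obtain ⟨T₁, hT, h⟩ := exists_early_hubble_eq_sqrt ha ha_pos ha_lim hA hm
      (fun t ht => hubble_sq ha ha_pos hM hE hρC ht)
    refine ⟨T₁, √(Λ / (3 * M ^ 2)), _, |C / (3 * M ^ 2)| / √(Λ / (3 * M ^ 2)), hT,
      Real.sqrt_pos.2 hA, hm, by positivity, fun _ => rfl, fun t ht => ⟨(h t ht).2.2, ?_⟩⟩
    rw [(h t ht).2.1]
    refine (abs_sqrt_sub_sqrt_le hA (h t ht).1.le).trans_eq ?_
    rw [abs_mul, abs_of_nonneg (Real.rpow_nonneg (ha_pos t (ht.trans_le hT)).le _)]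
    ring
  -- For `w = -1` the fluid shifts the vacuum energy, so `HΛ` is the actual constant value of `H`.
  -- The rate is trivial: `K = 0` with the arbitrary exponent `1`.
  · obtain ⟨H₀, hH₀, h⟩ := exists_hubble_eq_const ha ha_pos ha_lim fun t ht =>
      (friedmann ha ha_pos hM hE ht).2.congr_deriv (by norm_num)
    refine ⟨T, H₀, 1, 0, le_rfl, hH₀, one_pos, le_rfl, fun h => absurd h (lt_irrefl _),
      fun t ht => ⟨by rw [h t ht]; linarith, by rw [h t ht]; simp⟩⟩

lemma tendsto_hubble (ha_lim : Tendsto a atBot (𝓝 0)) {T₁ HΛ m K : ℝ} (hm : 0 < m)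
    (hH : ∀ t < T₁, |hubble a t - HΛ| ≤ K * a t ^ m) : Tendsto (hubble a) atBot (𝓝 HΛ) := by
  rw [tendsto_iff_norm_sub_tendsto_zero]
  have h := (tendsto_scale_rpow ha_lim hm.le).const_mul K
  rw [Real.zero_rpow hm.ne', mul_zero] at h
  refine squeeze_zero' (Eventually.of_forall fun t => norm_nonneg _) ?_ h
  filter_upwards [eventually_lt_atBot T₁] with t ht
  exact hH t ht

end

end FLRW

/-! ### Assembly of the theorem. -/

open FLRW in
theorem mainTheorem3 (M Λ w T : ℝ) (hM : 0 < M) (hΛ : 0 < Λ) (hw : w ≤ -1)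
    (a ρ : ℝ → ℝ) (ha : ContDiffOn ℝ 2 a (Iio T)) (ha_pos : ∀ t < T, 0 < a t)
    (ha_lim : Tendsto a atBot (𝓝 0))
    (hE : FLRW.SolvesEinstein M Λ w T a ρ) (hρ : ∃ t < T, ρ t ≠ 0) :
    -- the spacetime is asymptotically de Sitter in the past
    (∃ HΛ abar : ℝ, 0 < HΛ ∧ 0 < abar ∧ (w < -1 → HΛ = √(Λ / (3 * M ^ 2))) ∧
      a ~[atBot] fun t => abar * Real.exp (HΛ * t)) ∧
    -- null geodesics reach the past boundary at a finite affine parameter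
    FLRW.HasPastBoundary a T ∧
    -- the energy density, and the ratio of the time derivative of `H` to `a ^ 2`
    (∃ C : ℝ, C ≠ 0 ∧ ∀ t < T, ρ t = C * a t ^ (-3 * (1 + w)) ∧
      deriv (FLRW.hubble a) t / a t ^ 2
        = -(C / (2 * M ^ 2)) * ((1 + w) / a t ^ (5 + 3 * w))) ∧
    -- convergence of that ratio
    ((∃ L : ℝ, Tendsto (fun t => deriv (FLRW.hubble a) t / a t ^ 2) atBot (𝓝 L)) ↔
      w = -1 ∨ w ≤ -5 / 3) ∧
    -- continuous extendibility
    (FLRW.IsExtendible a T 0 ↔ w = -1 ∨ w ≤ -5 / 3) ∧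
    -- the singular range
    (-5 / 3 < w → w < -1 →
      Tendsto (fun t => |deriv (FLRW.hubble a) t / a t ^ 2|) atBot atTop ∧
      FLRW.IsPPCurvatureSingularity a T 0 ∧
      ∀ δ γ k E, FLRW.IsNullGeodesicFromPast a T δ γ k → FLRW.IsPPTetrad a δ γ k E →
        ∃ m, Tendsto (fun s => |FLRW.ppComponent a 0 γ E m s|) (𝓝[>] 0) atTop) ∧
    -- smooth extendibility
    (w ≤ -5 / 3 → (∃ n : ℤ, -5 - 3 * w = n) → FLRW.IsSmoothlyExtendible a T) ∧
    -- the largest possible class of extendibility in the remaining cases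
    (w ≤ -5 / 3 → (¬ ∃ n : ℤ, w = n / 3) →
      ∀ r : ℕ, FLRW.IsExtendible a T r → (r : ℤ) ≤ ⌊-3 * w⌋ - 5) := by
  obtain ⟨C, hC, hρC⟩ := exists_density_eq ha ha_pos hM hE hρ
  obtain ⟨T₁, HΛ, m, K, hT₁, hHΛ, hm, hK, hHΛ_eq, hH⟩ :=
    exists_hubble_asymptotics ha ha_pos ha_lim hM hΛ hw hE hρC
  have hHlim := tendsto_hubble ha_lim hm fun t ht => (hH t ht).2
  have hratio := fun t (ht : t < T) => deriv_hubble_div ha ha_pos hM hE hρC ht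
  have hratio_ev : (fun t => deriv (hubble a) t / a t ^ 2) =ᶠ[atBot]
      fun t => -(C * (1 + w) / (2 * M ^ 2)) * a t ^ (-5 - 3 * w) := by
    filter_upwards [eventually_lt_atBot T] with t ht using hratio t ht
  have hB : HasPastBoundary a T := by
    obtain ⟨δ, γ, k, E, hγ, hE', -⟩ := exists_nullGeodesic ha ha_pos ha_lim hT₁
      (le_mul_deriv_scale ha_pos hT₁ hHΛ fun t ht => (hH t ht).1)
    exact ⟨δ, γ, k, E, hγ, hE'⟩
  have hcoef : w < -1 → -(C * (1 + w) / (2 * M ^ 2)) ≠ 0 := fun h =>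
    neg_ne_zero.2 (div_ne_zero (mul_ne_zero hC (by linarith)) (by positivity))
  have hconv : w = -1 ∨ w ≤ -5 / 3 →
      ∃ L : ℝ, Tendsto (fun t => deriv (hubble a) t / a t ^ 2) atBot (𝓝 L) := by
    rintro (rfl | h)
    · exact ⟨0, tendsto_const_nhds.congr' (hratio_ev.mono fun t ht => by rw [ht]; norm_num)⟩
    · exact ⟨_, ((tendsto_scale_rpow ha_lim (by linarith)).const_mul _).congr' hratio_ev.symm⟩
  have hdiv : -5 / 3 < w → w < -1 →
      Tendsto (fun t => |deriv (hubble a) t / a t ^ 2|) atBot atTop := fun h1 h2 => by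
    have ha0 : Tendsto a atBot (𝓝[>] 0) := tendsto_nhdsWithin_iff.2 ⟨ha_lim, by
      filter_upwards [eventually_lt_atBot T] with t ht using ha_pos t ht⟩
    have h3 := ((tendsto_rpow_neg_nhdsGT_zero (show -5 - 3 * w < 0 by linarith)).comp
      ha0).const_mul_atTop (abs_pos.2 (hcoef h2))
    refine h3.congr' ?_
    filter_upwards [eventually_lt_atBot T] with t ht
    rw [hratio t ht, abs_mul, abs_of_pos (Real.rpow_pos_of_pos (ha_pos t ht) _)]
    rfl
  have hrange : ¬ (w = -1 ∨ w ≤ -5 / 3) → -5 / 3 < w ∧ w < -1 := fun h => by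
    rw [not_or, not_le] at h
    exact ⟨h.2, lt_of_le_of_ne hw h.1⟩
  have hA : 0 < Λ / (3 * M ^ 2) := by positivity
  refine ⟨?_, hB, ⟨C, hC, fun t ht => ⟨hρC t ht, ?_⟩⟩, ⟨fun ⟨L, hL⟩ => ?_, hconv⟩,
    ⟨fun hext => ?_, fun h => ?_⟩, fun h1 h2 => ⟨hdiv h1 h2, ?_, fun δ γ k E hγ hE' => ?_⟩,
    ?_, ?_⟩
  · obtain ⟨abar, habar, h⟩ := exists_isEquivalent_exp ha ha_pos ha_lim hT₁ hHΛ hm hK hH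
    exact ⟨HΛ, abar, hHΛ, habar, hHΛ_eq, h⟩
  · rw [hratio t ht, show -5 - 3 * w = -(5 + 3 * w) by ring, Real.rpow_neg (ha_pos t ht).le]
    ring
  · by_contra h
    exact not_tendsto_nhds_of_tendsto_atTop (hdiv (hrange h).1 (hrange h).2) _ hL.abs
  · by_contra h
    exact hext (isPPCurvatureSingularity_zero hB ha ha_pos ha_lim hHlim
      (hdiv (hrange h).1 (hrange h).2))
  · obtain ⟨L, hL⟩ := hconv h
    exact isExtendible_zero ha ha_pos ha_lim hHlim hL
  · exact isPPCurvatureSingularity_zero hB ha ha_pos ha_lim hHlim (hdiv h1 h2)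
  · exact exists_tendsto_abs_ppComponent hγ hE' ha ha_pos ha_lim hHlim (hdiv h1 h2)
  · rintro h ⟨n, hn⟩
    -- The bound `w ≤ -5/3` makes the exponent of `Ḣ/a²` a natural number `N`; that of the density
    -- is then `N + 2`.
    obtain ⟨N, rfl⟩ := Int.eq_ofNat_of_zero_le (show 0 ≤ n by
      have : (0 : ℝ) ≤ n := by rw [← hn]; linarith
      exact_mod_cast this)
    have hpow : ∀ t, a t ^ (-3 * (1 + w)) = a t ^ (N + 2) := fun t => by
      rw [← Real.rpow_natCast]; congr 1; push_cast at hn ⊢; linarith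
    obtain ⟨T₂, hT₂, h2⟩ := exists_early_hubble_eq_sqrt ha ha_pos ha_lim hA
      (show 0 < -3 * (1 + w) by linarith) (fun t ht => hubble_sq ha ha_pos hM hE hρC ht)
    simp only [hpow] at h2
    refine isSmoothlyExtendible_of_pow (C := -(C * (1 + w) / (2 * M ^ 2))) ha ha_pos ha_lim hT₂ hA
      (fun t ht => (h2 t ht).1) (fun t ht => ?_) (fun t ht => ?_)
    · rw [deriv_scale_eq ha_pos (ht.trans_le hT₂), (h2 t ht).2.1]
    · rw [hratio t (ht.trans_le hT₂), hn, Int.cast_natCast, Real.rpow_natCast]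
  · intro h hn r hr
    by_contra! hlt
    obtain ⟨T₂, hT₂, h2⟩ := exists_early_hubble_eq_sqrt ha ha_pos ha_lim hA
      (show 0 < -3 * (1 + w) by linarith) (fun t ht => hubble_sq ha ha_pos hM hE hρC ht)
    -- If `r` exceeds `⌊-3w⌋ - 5`, then `r + 5 ≥ ⌊-3w⌋ + 1 > -3w`.
    have hr' : -5 - 3 * w < r := by
      have h3 : (⌊-3 * w⌋ : ℝ) + 1 ≤ r + 5 := by exact_mod_cast (by lia : ⌊-3 * w⌋ + 1 ≤ r + 5)
      linarith [Int.lt_floor_add_one (-3 * w)]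
    refine hr (isPPCurvatureSingularity_of_rpow ha ha_pos ha_lim hT₂
      (le_mul_deriv_scale ha_pos hT₂ (Real.sqrt_pos.2 hA) fun t ht => (h2 t ht).2.2) hA
      -- An exponent `-5 - 3w = j` would give `w = (-5 - j)/3`, an excluded multiple of `1/3`.
      (show 0 < -3 * (1 + w) by linarith) (hcoef (by linarith)) (fun j hj => hn ⟨-5 - j, ?_⟩)
      (fun t ht => (h2 t ht).1) (fun t ht => ?_) (fun t ht => hratio t (ht.trans_le hT₂)) hr')
    · push_cast; linarith
    · rw [deriv_scale_eq ha_pos (ht.trans_le hT₂), (h2 t ht).2.1]
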